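/- Let $U^{\mathbb C}$ be a connected semisimple complex Lie group (equivalently, the complexification of a compact connected semisimple Lie group $U$) and let $\rho : U^{\mathbb C} \to \mathrm{SL}(n,\mathbb C)$ be an irreducible holomorphic representation. Let $G \subset U^{\mathbb C}$ be a noncompact connected real form, i.e. a noncompact closed connected subgroup whose (real) Lie algebra $\mathfrak g$ satisfies $\mathfrak u^{\mathbb C} = \mathfrak g \oplus i\mathfrak g$. Let $\mathcal O'$ be the unique compact orbit of the $U^{\mathbb C}$-action on $\mathbb P(\mathbb C^n)$, and let $\mathcal O$ be the unique compact orbit of the $G$-action on $\mathcal O'$. Suppose that there is an anti-holomorphic involution $T$ of $\mathbb P(\mathbb C^n)$ with $T(\mathcal O') = \mathcal O'$ and $T(p) = p$ for every $p \in \mathcal O$. Then there is a real subspace $V \subset \mathbb C^n$ with $\mathbb C^n = V \oplus iV$ (that is, $V^{\mathbb C} = \mathbb C^n$) which is invariant under $\rho(G)$ and on which $G$ acts irreducibly over $\mathbb R$. -/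

import Mathlib

open scoped Manifold ContDiff LinearAlgebra.Projectivization

noncomputable section

namespace RealForm

section LieGroups

variable {E : Type*} [NormedAddCommGroup E] [NormedSpace ℂ E]
  {H : Type*} [TopologicalSpace H] [ChartedSpace E H] [Group H]

/-- The Lie algebra of a closed subgroup `G` of a complex Lie group `H`, as a set of tangent
vectors of `H` at `1`: the velocities at time `0` of the real one-parameter subgroups
`γ : ℝ → H` of `H` (the curves `t ↦ exp (t X)`) that are contained in `G`. -/
def lieAlgebraOf (G : Subgroup H) : Set (GroupLieAlgebra 𝓘(ℂ, E) H) :=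
  {X | ∃ γ : ℝ → H, γ 0 = 1 ∧ (∀ s t : ℝ, γ (s + t) = γ s * γ t) ∧ (∀ t : ℝ, γ t ∈ G) ∧
    HasMFDerivAt 𝓘(ℝ, ℝ) 𝓘(ℝ, E) γ 0 (ContinuousLinearMap.toSpanSingleton ℝ (X : E))}

/-- `G` is a (closed, connected) real form of the complex Lie group `H`: its Lie algebra `𝔤`
is a real form of the Lie algebra `𝔥` of `H`, i.e. `𝔥 = 𝔤 ⊕ i𝔤`. -/
structure IsRealForm (G : Subgroup H) : Prop where
  isClosed : IsClosed (G : Set H)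
  isConnected : IsConnected (G : Set H)
  decomposition : ∀ Z : GroupLieAlgebra 𝓘(ℂ, E) H,
    ∃! p : GroupLieAlgebra 𝓘(ℂ, E) H × GroupLieAlgebra 𝓘(ℂ, E) H,
      p.1 ∈ lieAlgebraOf G ∧ p.2 ∈ lieAlgebraOf G ∧ Z = p.1 + Complex.I • p.2

/-- `ρ : H → SL(n, ℂ)` is holomorphic: all of its matrix entries are holomorphic functions. -/
def IsHolomorphicRep {n : ℕ} (ρ : H →* Matrix.SpecialLinearGroup (Fin n) ℂ) : Prop :=
  ∀ i j, MDifferentiable 𝓘(ℂ, E) 𝓘(ℂ, ℂ) (fun h : H => (ρ h).1 i j)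

end LieGroups

section Representations

variable {H : Type*} [Group H] {n : ℕ}

/-- The representation of `H` on `ℂⁿ` given by a homomorphism `ρ : H → SL(n, ℂ)`. -/
def complexRep (ρ : H →* Matrix.SpecialLinearGroup (Fin n) ℂ) :
    Representation ℂ H (Fin n → ℂ) :=
  (Representation.ofDistribMulAction ℂ (Matrix.SpecialLinearGroup (Fin n) ℂ) (Fin n → ℂ)).comp ρ

/-- The real representation on `ℂⁿ` of a subgroup `G ≤ H`, obtained by restricting `ρ` to `G`
and regarding `ℂⁿ` as a real vector space. -/
def realRep (ρ : H →* Matrix.SpecialLinearGroup (Fin n) ℂ) (G : Subgroup H) :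
    Representation ℝ G (Fin n → ℂ) where
  toFun g := (complexRep ρ g).restrictScalars ℝ
  map_one' := by ext; simp
  map_mul' a b := by ext; simp

/-- Multiplication by `i` on `ℂⁿ`, as a real linear map. -/
def mulI (n : ℕ) : (Fin n → ℂ) →ₗ[ℝ] (Fin n → ℂ) :=
  (LinearMap.lsmul ℂ (Fin n → ℂ) Complex.I).restrictScalars ℝ

/-- `V^ℂ = ℂⁿ` for a real subspace `V ⊆ ℂⁿ`, i.e. `ℂⁿ = V ⊕ iV`. -/
def ComplexificationEqTop (V : Submodule ℝ (Fin n → ℂ)) : Prop :=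
  IsCompl V (V.map (mulI n))

end Representations

section ProjectiveSpace

variable {n : ℕ}

/-- The topology of `ℙ(ℂⁿ)`: the quotient topology from `ℂⁿ ∖ {0}`. -/
instance projectiveTopology : TopologicalSpace (ℙ ℂ (Fin n → ℂ)) :=
  TopologicalSpace.coinduced
    (fun v : {v : Fin n → ℂ // v ≠ 0} => Projectivization.mk ℂ v.1 v.2) inferInstance

/-- `T : ℙ(ℂⁿ) → ℙ(ℂⁿ)` is anti-holomorphic: locally on `ℂⁿ ∖ {0}` it has the form
`[v] ↦ [F v]` for a nowhere vanishing anti-holomorphic map `F` (i.e. the conjugate of `F` is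
holomorphic). As `ℂⁿ ∖ {0} → ℙ(ℂⁿ)` is a holomorphic submersion, and thus has local holomorphic
sections, this is the same as being anti-holomorphic in the affine charts of `ℙ(ℂⁿ)`. -/
def IsAntiholomorphic (T : ℙ ℂ (Fin n → ℂ) → ℙ ℂ (Fin n → ℂ)) : Prop :=
  ∀ v₀ : Fin n → ℂ, v₀ ≠ 0 → ∃ U : Set (Fin n → ℂ), IsOpen U ∧ v₀ ∈ U ∧
    ∃ F : (Fin n → ℂ) → (Fin n → ℂ), DifferentiableOn ℂ (fun v => star (F v)) U ∧
      ∀ v ∈ U, ∀ hv : v ≠ 0, ∃ hF : F v ≠ 0,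
        T (Projectivization.mk ℂ v hv) = Projectivization.mk ℂ (F v) hF

variable {H : Type*} [Group H]

/-- `O` is a compact orbit in `ℙ(ℂⁿ)` of the subgroup `G ≤ H` acting through `ρ`. -/
def IsCompactOrbit (ρ : H →* Matrix.SpecialLinearGroup (Fin n) ℂ) (G : Subgroup H)
    (O : Set (ℙ ℂ (Fin n → ℂ))) : Prop :=
  IsCompact O ∧ ∃ p : ℙ ℂ (Fin n → ℂ), O = MulAction.orbit (G.map ρ) p

end ProjectiveSpace

end RealForm

end

/-! An anti-holomorphic involution `T` of projective space comes from an antilinear map `τ`, because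
biholomorphic self-maps of projective space are linear (`IsHolomorphicMap.exists_linear`, applied to
`T` followed by conjugation). Since `T` fixes the orbit of `[v]` under `G` pointwise, `τ` preserves
every line `ℂ ρ(g)v`, and a rescaling gives `τ v = v`.

Irreducibility passes from `H` to `G`: a complex subspace stable under `G` is stable under `𝔤 + i𝔤 =
𝔥`, hence under the connected group `H` (`IsRealForm.repCLM_apply_mem`). The orbit `G v` therefore
spans `ℂⁿ`, and a linear map with all orbit vectors as eigenvectors is a scalar, because its
eigenvalue varies continuously over the connected group `G` within a finite set
(`IsRealForm.eq_smul_of_forall_orbit`).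

Applied to `τ²` this gives `τ² = 1`. Applied to `τ ρ(g) τ ρ(g)⁻¹` it gives a scalar, which is an
`n`-th root of unity since `det ρ(g) = 1`, and is `1` by connectedness. So `τ` is a real structure
commuting with `G`. Its fixed space is `V`; the complex span of an invariant real subspace of `V` is
`0` or `ℂⁿ`, which makes `V` irreducible. -/

noncomputable section

open scoped Topology Matrix

namespace RealForm

/-! ### Holomorphy of derivatives in several complex variables -/

section SeveralComplexVariables

variable {X Y : Type*} [NormedAddCommGroup X] [NormedSpace ℂ X]
  [NormedAddCommGroup Y] [NormedSpace ℂ Y] [FiniteDimensional ℂ Y]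

/-- Cauchy's estimate for the Fréchet derivative. -/
theorem norm_fderiv_le_of_forall_mem_ball {f : X → Y} {x : X} {r C : ℝ} (hr : 0 < r)
    (hC : 0 ≤ C) (hf : ∀ y ∈ Metric.closedBall x r, DifferentiableAt ℂ f y)
    (hb : ∀ y ∈ Metric.closedBall x r, ‖f y‖ ≤ C) : ‖fderiv ℂ f x‖ ≤ C / r := by
  have : CompleteSpace Y := FiniteDimensional.complete ℂ Y
  refine ContinuousLinearMap.opNorm_le_bound _ (by positivity) fun u => ?_
  rcases eq_or_ne u 0 with rfl | hu
  · simp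
  have hu' : 0 < ‖u‖ := norm_pos_iff.mpr hu
  -- On the complex line `x + t u` the one-variable Cauchy estimate applies, on a disc of radius `r
  -- / ‖u‖`.
  have hmem : ∀ t ∈ Metric.closedBall (0 : ℂ) (r / ‖u‖), x + t • u ∈ Metric.closedBall x r := by
    intro t ht
    rw [mem_closedBall_zero_iff, le_div_iff₀ hu'] at ht
    simpa [norm_smul] using ht
  have hd : ∀ t ∈ Metric.closedBall (0 : ℂ) (r / ‖u‖),
      DifferentiableAt ℂ (fun t : ℂ => f (x + t • u)) t := fun t ht =>
    (hf _ (hmem t ht)).comp t (by fun_prop)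
  have h0 : deriv (fun t : ℂ => f (x + t • u)) 0 = fderiv ℂ f x u := by
    have h1 : HasDerivAt (fun t : ℂ => x + t • u) u 0 := by
      simpa using ((hasDerivAt_id (0 : ℂ)).smul_const u).const_add x
    have h2 : HasFDerivAt f (fderiv ℂ f x) (x + (0 : ℂ) • u) := by
      simpa using (hf x (Metric.mem_closedBall_self hr.le)).hasFDerivAt
    exact (h2.comp_hasDerivAt 0 h1).deriv
  have hc : DiffContOnCl ℂ (fun t : ℂ => f (x + t • u)) (Metric.ball 0 (r / ‖u‖)) := by
    apply DifferentiableOn.diffContOnCl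
    rw [closure_ball _ (by positivity)]
    exact fun t ht => (hd t ht).differentiableWithinAt
  have := Complex.norm_deriv_le_of_forall_mem_sphere_norm_le (C := C) (div_pos hr hu') hc
    fun t ht => hb _ (hmem t (Metric.sphere_subset_closedBall ht))
  rw [h0] at this
  calc _ ≤ _ := this
    _ = _ := by field_simp

/-- A directional derivative of a holomorphic function of several variables is holomorphic. -/
theorem differentiableOn_fderiv_apply [FiniteDimensional ℂ X] {f : X → Y} {U : Set X}
    (hU : IsOpen U) (hf : DifferentiableOn ℂ f U) (w : X) :
    DifferentiableOn ℂ (fun v => fderiv ℂ f v w) U := by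
  have : CompleteSpace Y := FiniteDimensional.complete ℂ Y
  have : ProperSpace X := FiniteDimensional.proper ℂ X
  borelize X
  intro v₀ hv₀
  refine DifferentiableAt.differentiableWithinAt ?_
  obtain ⟨R, hR, hRU⟩ := Metric.nhds_basis_closedBall.mem_iff.mp (hU.mem_nhds hv₀)
  obtain ⟨C, hC⟩ := (isCompact_closedBall v₀ R).exists_bound_of_continuousOn
    (hf.continuousOn.mono hRU)
  have hC0 : 0 ≤ C := (norm_nonneg _).trans (hC v₀ (Metric.mem_closedBall_self hR.le))
  have hfd : ∀ y ∈ Metric.closedBall v₀ R, DifferentiableAt ℂ f y := fun y hy =>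
    hf.differentiableAt (hU.mem_nhds (hRU hy))
  -- The radius `R` is spent in thirds: moving the base point, moving along the circle in direction
  -- `w`, and the Cauchy estimate at the resulting point. The `+ 1` covers `w = 0`.
  set r : ℝ := R / 3 / (‖w‖ + 1)
  have hr : 0 < r := by positivity
  have hrw : r * ‖w‖ ≤ R / 3 := by
    simp only [r]
    rw [div_mul_eq_mul_div, div_le_iff₀ (by positivity)]
    nlinarith [norm_nonneg w]
  have hmem : ∀ x ∈ Metric.ball v₀ (R / 3), ∀ z ∈ Metric.closedBall (0 : ℂ) r,
      ∀ y ∈ Metric.closedBall (x + z • w) (R / 3), y ∈ Metric.closedBall v₀ R := by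
    intro x hx z hz y hy
    rw [mem_closedBall_zero_iff] at hz
    rw [mem_ball_iff_norm] at hx
    rw [mem_closedBall_iff_norm] at hy ⊢
    have h1 : ‖z • w‖ ≤ R / 3 := by
      rw [norm_smul]
      exact (mul_le_mul_of_nonneg_right hz (norm_nonneg w)).trans hrw
    have h2 : y - v₀ = (y - (x + z • w)) + (x - v₀) + z • w := by abel
    rw [h2]
    linarith [norm_add₃_le (a := y - (x + z • w)) (b := x - v₀) (c := z • w)]
  have hmem' : ∀ x ∈ Metric.ball v₀ (R / 3), ∀ z ∈ Metric.closedBall (0 : ℂ) r,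
      x + z • w ∈ Metric.closedBall v₀ R := fun x hx z hz =>
    hmem x hx z hz _ (Metric.mem_closedBall_self (by positivity))
  have hbd : ∀ x ∈ Metric.ball v₀ (R / 3), ∀ z ∈ Metric.closedBall (0 : ℂ) r,
      ‖fderiv ℂ f (x + z • w)‖ ≤ C / (R / 3) := fun x hx z hz =>
    norm_fderiv_le_of_forall_mem_ball (by positivity) hC0
      (fun y hy => hfd y (hmem x hx z hz y hy)) fun y hy => hC y (hmem x hx z hz y hy)
  -- Up to the factor `(2πi)⁻¹`, the kernel of Cauchy's formula for the first derivative at the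
  -- centre of a circle.
  set k : ℝ → ℂ := fun θ => deriv (circleMap 0 r) θ * ((circleMap 0 r θ - 0) ^ 2)⁻¹
  have hk : Continuous k := by
    simp only [k, deriv_circleMap]
    refine Continuous.mul (by fun_prop) (Continuous.inv₀ (by fun_prop) fun θ => ?_)
    simpa using hr.ne'
  have hcirc : ∀ θ, circleMap 0 r θ ∈ Metric.closedBall (0 : ℂ) r := fun θ =>
    circleMap_mem_closedBall _ hr.le θ
  have hcont : ∀ x ∈ Metric.ball v₀ (R / 3),
      Continuous (fun θ => k θ • f (x + circleMap 0 r θ • w)) := by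
    intro x hx
    refine hk.smul ?_
    rw [continuous_iff_continuousAt]
    intro θ
    exact ContinuousAt.comp (f := fun θ => x + circleMap 0 r θ • w)
      (hfd _ (hmem' x hx _ (hcirc θ))).continuousAt (by fun_prop)
  -- The directional derivative is a Cauchy integral of `f` itself, so differentiating under the
  -- integral needs only first derivatives of `f`. These are measurable and bounded by Cauchy's
  -- estimate; their continuity is not needed.
  have key := (intervalIntegral.hasFDerivAt_integral_of_dominated_of_fderiv_le (𝕜 := ℂ)
    (μ := MeasureTheory.volume) (a := 0) (b := 2 * Real.pi)
    (F := fun x θ => k θ • f (x + circleMap 0 r θ • w))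
    (F' := fun x θ => k θ • fderiv ℂ f (x + circleMap 0 r θ • w)) (x₀ := v₀)
    (s := Metric.ball v₀ (R / 3)) (bound := fun θ => ‖k θ‖ * (C / (R / 3)))
    (Metric.ball_mem_nhds _ (by positivity))
    (Filter.eventually_of_mem (Metric.ball_mem_nhds v₀ (by positivity : 0 < R / 3))
      fun x hx => (hcont x hx).aestronglyMeasurable)
    ((hcont v₀ (Metric.mem_ball_self (by positivity))).intervalIntegrable _ _)
    (hk.aestronglyMeasurable.smul
      (((measurable_fderiv ℂ f).comp (by fun_prop : Continuous fun θ =>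
        v₀ + circleMap 0 r θ • w).measurable).aestronglyMeasurable))
    (Filter.Eventually.of_forall fun θ _ x hx => by
      rw [norm_smul]
      exact mul_le_mul_of_nonneg_left (hbd x hx _ (hcirc θ)) (norm_nonneg _))
    (by apply Continuous.intervalIntegrable; fun_prop)
    (Filter.Eventually.of_forall fun θ _ x hx => by
      have h1 : HasFDerivAt (fun x => x + circleMap 0 r θ • w) (ContinuousLinearMap.id ℂ X) x :=
        (hasFDerivAt_id x).add_const _
      have h2 := (hfd _ (hmem' x hx _ (hcirc θ))).hasFDerivAt.comp x h1
      exact (h2.const_smul (k θ)))).differentiableAt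
  refine (key.const_smul ((2 * Real.pi * Complex.I : ℂ)⁻¹)).congr_of_eventuallyEq ?_
  filter_upwards [Metric.ball_mem_nhds v₀ (by positivity : 0 < R / 3)] with x hx
  have hV : IsOpen ((fun z : ℂ => x + z • w) ⁻¹' U) := hU.preimage (by fun_prop)
  have hg : DifferentiableOn ℂ (fun z : ℂ => f (x + z • w)) ((fun z : ℂ => x + z • w) ⁻¹' U) :=
    hf.comp (by fun_prop) fun _ h => h
  have h0 := Complex.two_pi_I_inv_smul_circleIntegral_sub_sq_inv_smul_of_differentiable hV
    (c := 0) (R := r) (w₀ := 0) (fun z hz => hRU (hmem' x hx z hz)) hg (Metric.mem_ball_self hr)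
  have h1 : deriv (fun t : ℂ => f (x + t • w)) 0 = fderiv ℂ f x w := by
    have h1 : HasDerivAt (fun t : ℂ => x + t • w) w 0 := by
      simpa using ((hasDerivAt_id (0 : ℂ)).smul_const w).const_add x
    have h2 : HasFDerivAt f (fderiv ℂ f x) (x + (0 : ℂ) • w) := by
      simpa using (hfd x (by simpa using hmem' x hx 0 (Metric.mem_closedBall_self hr.le))).hasFDerivAt
    exact (h2.comp_hasDerivAt 0 h1).deriv
  rw [← h1, ← h0, circleIntegral]
  simp only [k, smul_smul, Pi.smul_apply]

end SeveralComplexVariables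

/-! ### Biholomorphic self-maps of projective space are linear -/

section ProjectiveMaps

/-- Finite sets in a T1 space are discrete. This is what turns "determined up to a root of unity"
into "locally constant". -/
theorem eventually_eq_of_mem_finite {α β : Type*} [TopologicalSpace α] [TopologicalSpace β]
    [T1Space β] {f : α → β} {a : α} {s : Set β} (hs : s.Finite) (hf : ContinuousAt f a)
    (h : ∀ᶠ x in 𝓝 a, f x ∈ s) : ∀ᶠ x in 𝓝 a, f x = f a := by
  have h1 : (s \ {f a})ᶜ ∈ 𝓝 (f a) :=
    (hs.subset Set.sdiff_subset).isClosed.isOpen_compl.mem_nhds (by simp)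
  filter_upwards [h, hf h1] with x hx hx'
  by_contra hne
  exact hx' ⟨hx, hne⟩

theorem finite_setOf_pow_eq {n : ℕ} (hn : n ≠ 0) (c : ℂ) : {z : ℂ | z ^ n = c}.Finite := by
  classical
  refine (Polynomial.nthRootsFinset n c).finite_toSet.subset fun z hz => ?_
  simpa [Polynomial.mem_nthRootsFinset (Nat.pos_of_ne_zero hn)] using hz

/-! ### Homogeneous holomorphic functions -/

section Homogeneous

variable {X : Type*} [NormedAddCommGroup X] [NormedSpace ℂ X]

theorem differentiableOn_fun_div {f g : X → ℂ} {U : Set X} (hf : DifferentiableOn ℂ f U)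
    (hg : DifferentiableOn ℂ g U) (h0 : ∀ x ∈ U, g x ≠ 0) :
    DifferentiableOn ℂ (fun x => f x / g x) U := by
  simp only [div_eq_mul_inv]
  exact hf.mul (hg.inv h0)

theorem eventually_smul_mem {U : Set X} (hU : IsOpen U) {v : X} (hv : v ∈ U) :
    ∀ᶠ c : ℂ in 𝓝 1, c • v ∈ U := by
  have h : ContinuousAt (fun c : ℂ => c • v) 1 := by fun_prop
  exact h (by simpa using hU.mem_nhds hv)

/-- Euler's identity in degree one. -/
theorem fderiv_apply_self_of_homogeneous {Y : Type*} [NormedAddCommGroup Y] [NormedSpace ℂ Y]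
    {f : X → Y} {U : Set X} (hU : IsOpen U)
    (hf : DifferentiableOn ℂ f U) (hom : ∀ v ∈ U, ∀ c : ℂ, c • v ∈ U → f (c • v) = c • f v)
    {v : X} (hv : v ∈ U) : fderiv ℂ f v v = f v := by
  have h1 : HasDerivAt (fun c : ℂ => c • v) v 1 := by
    simpa using (hasDerivAt_id (1 : ℂ)).smul_const v
  have h2 : HasFDerivAt f (fderiv ℂ f v) ((1 : ℂ) • v) := by
    simpa using (hf.differentiableAt (hU.mem_nhds hv)).hasFDerivAt
  have h3 : HasDerivAt (fun c : ℂ => c • f v) (f v) 1 := by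
    simpa using (hasDerivAt_id (1 : ℂ)).smul_const (f v)
  refine (h2.comp_hasDerivAt 1 h1).unique (h3.congr_of_eventuallyEq ?_)
  filter_upwards [eventually_smul_mem hU hv] with c hc using hom v hv c hc

/-- Euler's identity in degree zero. -/
theorem fderiv_apply_self_of_invariant {Y : Type*} [NormedAddCommGroup Y] [NormedSpace ℂ Y]
    {f : X → Y} {U : Set X} (hU : IsOpen U)
    (hf : DifferentiableOn ℂ f U) (hom : ∀ v ∈ U, ∀ c : ℂ, c • v ∈ U → f (c • v) = f v)
    {v : X} (hv : v ∈ U) : fderiv ℂ f v v = 0 := by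
  have h1 : HasDerivAt (fun c : ℂ => c • v) v 1 := by
    simpa using (hasDerivAt_id (1 : ℂ)).smul_const v
  have h2 : HasFDerivAt f (fderiv ℂ f v) ((1 : ℂ) • v) := by
    simpa using (hf.differentiableAt (hU.mem_nhds hv)).hasFDerivAt
  refine (h2.comp_hasDerivAt 1 h1).unique
    ((hasDerivAt_const (1 : ℂ) (f v)).congr_of_eventuallyEq ?_)
  filter_upwards [eventually_smul_mem hU hv] with c hc using hom v hv c hc

/-- The Jacobian determinant of `u • F` for `F` homogeneous of degree one and `u` homogeneous of
degree zero. -/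
theorem det_fderiv_smul [FiniteDimensional ℂ X] {F : X → X} {u : X → ℂ} {v : X}
    (hF : DifferentiableAt ℂ F v) (hu : DifferentiableAt ℂ u v)
    (hFv : fderiv ℂ F v v = F v) (huv : fderiv ℂ u v v = 0) (h0 : u v ≠ 0) :
    (fderiv ℂ (fun x => u x • F x) v).det
      = u v ^ Module.finrank ℂ X * (fderiv ℂ F v).det := by
  have h1 : fderiv ℂ (fun x => u x • F x) v
      = u v • fderiv ℂ F v + (fderiv ℂ u v).smulRight (F v) := fderiv_fun_smul hu hF
  -- By Euler's identity `F v = DF v`, the rank-one term `Du ⊗ F v` factors through `DF`. What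
  -- remains is `id + u⁻¹ Du ⊗ v`, with determinant `1 + u⁻¹ Du(v) = 1`.
  have h2 : ((fderiv ℂ (fun x => u x • F x) v : X →L[ℂ] X) : X →ₗ[ℂ] X)
      = (u v • (fderiv ℂ F v : X →ₗ[ℂ] X)) ∘ₗ
        LinearMap.transvection ((u v)⁻¹ • (fderiv ℂ u v : X →ₗ[ℂ] ℂ)) v := by
    rw [h1]
    ext w
    simp [LinearMap.transvection.apply, hFv, smul_smul, mul_inv_cancel_left₀ h0]
  rw [ContinuousLinearMap.det, h2, LinearMap.det_comp, LinearMap.transvection.det,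
    LinearMap.det_smul]
  simp [huv, ContinuousLinearMap.det]

/-- Differentiate `F (c x) = c F x` in `x` and cancel `c`. Consequently the Jacobian determinant is
homogeneous of degree zero. -/
theorem fderiv_smul_eq_of_homogeneous {F : X → X} {U : Set X} (hU : IsOpen U)
    (hF : DifferentiableOn ℂ F U) (hom : ∀ v ∈ U, ∀ c : ℂ, c • v ∈ U → F (c • v) = c • F v)
    {v : X} (hv : v ∈ U) {c : ℂ} (hc : c ≠ 0) (hcv : c • v ∈ U) :
    fderiv ℂ F (c • v) = fderiv ℂ F v := by
  have h1 : HasFDerivAt (fun x : X => c • x) (c • ContinuousLinearMap.id ℂ X) v :=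
    (hasFDerivAt_id v).const_smul c
  have h2 := ((hF.differentiableAt (hU.mem_nhds hcv)).hasFDerivAt (x := c • v)).comp v h1
  have h3 := (hF.differentiableAt (hU.mem_nhds hv)).hasFDerivAt.const_smul c
  have h4 : ∀ᶠ x in 𝓝 v, c • F x = F (c • x) := by
    have h : ContinuousAt (fun x : X => c • x) v := by fun_prop
    filter_upwards [hU.mem_nhds hv, h (hU.mem_nhds hcv)] with x hx hx'
    exact (hom x hx c hx').symm
  have h5 := h2.unique (h3.congr_of_eventuallyEq (h4.mono fun x hx => hx.symm))
  ext w
  have h6 := congrArg (fun L : X →L[ℂ] X => L w) h5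
  simp only [ContinuousLinearMap.comp_smul, ContinuousLinearMap.comp_id,
    smul_apply] at h6
  exact smul_right_injective X hc h6

/-- A holomorphic function on `X ∖ {0}` that is homogeneous of degree zero is constant. -/
theorem eq_of_differentiableAt_of_smul_invariant [FiniteDimensional ℂ X] {P : X → ℂ}
    (hP : ∀ v, v ≠ 0 → DifferentiableAt ℂ P v)
    (hinv : ∀ (c : ℂ) (v : X), c ≠ 0 → v ≠ 0 → P (c • v) = P v) {v w : X} (hv : v ≠ 0)
    (hw : w ≠ 0) : P v = P w := by
  have : ProperSpace X := FiniteDimensional.proper ℂ X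
  obtain ⟨C, hC⟩ := (isCompact_sphere (0 : X) 1).exists_bound_of_continuousOn (f := P)
    fun x hx => (hP x (Metric.ne_of_mem_sphere hx one_ne_zero)).continuousAt.continuousWithinAt
  have hbound : ∀ x, x ≠ 0 → ‖P x‖ ≤ C := by
    intro x hx
    have hx' : ((‖x‖ : ℂ)⁻¹) ≠ 0 := by simpa using hx
    rw [← hinv _ x hx' hx]
    refine hC _ ?_
    rw [mem_sphere_zero_iff_norm, norm_smul]
    simp [hx]
  -- If `w` is not a multiple of `v`, the complex line through `v` and `w` misses `0`, and
  -- Liouville's theorem applies on it; otherwise homogeneity is enough.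
  by_cases hli : ∃ c : ℂ, w = c • v
  · obtain ⟨c, rfl⟩ := hli
    exact (hinv c v (fun h => hw (by simp [h])) hv).symm
  · have hne : ∀ t : ℂ, v + t • (w - v) ≠ 0 := by
      intro t ht
      rcases eq_or_ne t 0 with rfl | h0
      · exact hv (by simpa using ht)
      · refine hli ⟨t⁻¹ * (t - 1), ?_⟩
        have h1 : t • w = (t - 1) • v := by
          rw [sub_smul, one_smul, ← sub_eq_zero, ← ht, smul_sub]; abel
        rw [mul_smul, ← h1, smul_smul, inv_mul_cancel₀ h0, one_smul]
    have hd : Differentiable ℂ fun t : ℂ => P (v + t • (w - v)) := fun t =>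
      (hP _ (hne t)).comp t (by fun_prop)
    have hb : Bornology.IsBounded (Set.range fun t : ℂ => P (v + t • (w - v))) := by
      refine isBounded_iff_forall_norm_le.mpr ⟨C, ?_⟩
      rintro _ ⟨t, rfl⟩
      exact hbound _ (hne t)
    simpa using hd.apply_eq_apply_of_bounded hb 0 1

end Homogeneous

/-! ### Local lifts and their normalisation -/

variable {n : ℕ}

/-- `F` is a holomorphic local lift, over the open set `U` of `ℂⁿ ∖ {0}`, of the self-map `S`
of `ℙ(ℂⁿ)`. -/
structure IsLift (S : ℙ ℂ (Fin n → ℂ) → ℙ ℂ (Fin n → ℂ)) (U : Set (Fin n → ℂ))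
    (F : (Fin n → ℂ) → (Fin n → ℂ)) : Prop where
  isOpen : IsOpen U
  differentiableOn : DifferentiableOn ℂ F U
  lift : ∀ v ∈ U, ∃ (hv : v ≠ 0) (hF : F v ≠ 0),
    S (Projectivization.mk ℂ v hv) = Projectivization.mk ℂ (F v) hF

/-- A lift that is homogeneous of degree one. -/
structure IsHomogeneousLift (S : ℙ ℂ (Fin n → ℂ) → ℙ ℂ (Fin n → ℂ)) (U : Set (Fin n → ℂ))
    (F : (Fin n → ℂ) → (Fin n → ℂ)) : Prop extends IsLift S U F where
  homogeneous : ∀ v ∈ U, ∀ c : ℂ, c • v ∈ U → F (c • v) = c • F v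

/-- A homogeneous lift with Jacobian determinant one. -/
structure IsUnimodularLift (S : ℙ ℂ (Fin n → ℂ) → ℙ ℂ (Fin n → ℂ)) (U : Set (Fin n → ℂ))
    (F : (Fin n → ℂ) → (Fin n → ℂ)) : Prop extends IsHomogeneousLift S U F where
  det_eq_one : ∀ v ∈ U, (fderiv ℂ F v).det = 1

/-- A self-map of `ℙ(ℂⁿ)` is holomorphic if it has holomorphic local lifts. -/
def IsHolomorphicMap (S : ℙ ℂ (Fin n → ℂ) → ℙ ℂ (Fin n → ℂ)) : Prop :=
  ∀ v : Fin n → ℂ, v ≠ 0 → ∃ U F, v ∈ U ∧ IsLift S U F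

variable {S R : ℙ ℂ (Fin n → ℂ) → ℙ ℂ (Fin n → ℂ)} {U U' : Set (Fin n → ℂ)}
  {F F' : (Fin n → ℂ) → (Fin n → ℂ)}

theorem IsLift.differentiableAt (h : IsLift S U F) {v : Fin n → ℂ} (hv : v ∈ U) :
    DifferentiableAt ℂ F v :=
  h.differentiableOn.differentiableAt (h.isOpen.mem_nhds hv)

theorem IsLift.exists_smul_eq (h : IsLift S U F) (h' : IsLift S U' F') {v : Fin n → ℂ} {c : ℂ}
    (hv : v ∈ U) (hv' : c • v ∈ U') : ∃ a : ℂ, a ≠ 0 ∧ F' (c • v) = a • F v := by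
  obtain ⟨h0, hF, e⟩ := h.lift v hv
  obtain ⟨h0', hF', e'⟩ := h'.lift _ hv'
  have hc : c ≠ 0 := by rintro rfl; simp at h0'
  have h1 : Projectivization.mk ℂ (c • v) h0' = Projectivization.mk ℂ v h0 :=
    (Projectivization.mk_eq_mk_iff' ℂ _ _ _ _).mpr ⟨c, rfl⟩
  rw [h1, e] at e'
  obtain ⟨a, ha⟩ := (Projectivization.mk_eq_mk_iff' ℂ _ _ _ _).mp e'.symm
  exact ⟨a, fun h => hF' (by rw [← ha, h, zero_smul]), ha.symm⟩

theorem IsLift.mono (h : IsLift S U F) (hU' : IsOpen U') (hsub : U' ⊆ U) : IsLift S U' F :=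
  ⟨hU', h.differentiableOn.mono hsub, fun v hv => h.lift v (hsub hv)⟩

theorem IsLift.smul (h : IsLift S U F) {u : (Fin n → ℂ) → ℂ} (hu : DifferentiableOn ℂ u U)
    (h0 : ∀ v ∈ U, u v ≠ 0) : IsLift S U fun v => u v • F v := by
  refine ⟨h.isOpen, hu.smul h.differentiableOn, fun v hv => ?_⟩
  obtain ⟨hv0, hF, e⟩ := h.lift v hv
  refine ⟨hv0, smul_ne_zero (h0 v hv) hF, e.trans ?_⟩
  exact ((Projectivization.mk_eq_mk_iff' ℂ _ _ _ _).mpr ⟨u v, rfl⟩).symm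

/-- `F x / (F x)ᵢ` depends only on the line of `x`; multiplying by a coordinate `xⱼ` makes the
degree one. -/
theorem IsLift.exists_homogeneous (h : IsLift S U F) {v : Fin n → ℂ} (hv : v ∈ U) :
    ∃ U' F', v ∈ U' ∧ IsHomogeneousLift S U' F' := by
  obtain ⟨hv0, hF, -⟩ := h.lift v hv
  obtain ⟨i, hi⟩ := Function.ne_iff.mp hF
  obtain ⟨j, hj⟩ := Function.ne_iff.mp hv0
  have hFi : DifferentiableOn ℂ (fun x => F x i) U := differentiableOn_pi.mp h.differentiableOn i
  have hxj : Differentiable ℂ fun x : Fin n → ℂ => x j := by fun_prop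
  set V : Set (Fin n → ℂ) := (U ∩ (fun x => F x i) ⁻¹' {0}ᶜ) ∩ (fun x => x j) ⁻¹' {0}ᶜ
  have hV : IsOpen V := (hFi.continuousOn.isOpen_inter_preimage h.isOpen
    isOpen_compl_singleton).inter (isOpen_compl_singleton.preimage hxj.continuous)
  have hVU : V ⊆ U := fun x hx => hx.1.1
  refine ⟨V, fun x => (x j / F x i) • F x, ⟨⟨hv, hi⟩, hj⟩,
    (h.mono hV hVU).smul (differentiableOn_fun_div hxj.differentiableOn (hFi.mono hVU)
      fun x hx => hx.1.2)
      fun x hx => div_ne_zero hx.2 hx.1.2, ?_⟩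
  intro x hx c hcx
  obtain ⟨a, ha, hFa⟩ := h.exists_smul_eq h (hVU hx) (hVU hcx)
  have h1 : F x i ≠ 0 := hx.1.2
  ext k
  simp only [hFa, Pi.smul_apply, smul_eq_mul]
  field_simp

theorem IsHomogeneousLift.fderiv_apply_self (h : IsHomogeneousLift S U F) {v : Fin n → ℂ}
    (hv : v ∈ U) : fderiv ℂ F v v = F v :=
  fderiv_apply_self_of_homogeneous h.isOpen h.differentiableOn h.homogeneous hv

theorem IsHomogeneousLift.mono (h : IsHomogeneousLift S U F) (hU' : IsOpen U') (hsub : U' ⊆ U) :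
    IsHomogeneousLift S U' F :=
  ⟨h.toIsLift.mono hU' hsub, fun v hv c hc => h.homogeneous v (hsub hv) c (hsub hc)⟩

theorem IsHomogeneousLift.smul (h : IsHomogeneousLift S U F) {u : (Fin n → ℂ) → ℂ}
    (hu : DifferentiableOn ℂ u U) (h0 : ∀ v ∈ U, u v ≠ 0)
    (hom : ∀ v ∈ U, ∀ c : ℂ, c • v ∈ U → u (c • v) = u v) :
    IsHomogeneousLift S U fun v => u v • F v :=
  ⟨h.toIsLift.smul hu h0, fun v hv c hc => by
    rw [h.homogeneous v hv c hc, hom v hv c hc, smul_comm]⟩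

/-- Composing with a lift `Ψ` of `R` gives a lift of the identity, so `Ψ (F x)` is a scalar function
times `x`. Differentiating along a kernel vector `w` of `DF` shows `w ∈ ℂ v`, which is impossible
because `DF v = F v ≠ 0`. -/
theorem IsHomogeneousLift.det_ne_zero (h : IsHomogeneousLift S U F) (hR : IsHolomorphicMap R)
    (hRS : Function.LeftInverse R S) {v : Fin n → ℂ} (hv : v ∈ U) : (fderiv ℂ F v).det ≠ 0 := by
  intro hdet
  obtain ⟨w, hwker, hw⟩ := (Submodule.ne_bot_iff _).mp
    (LinearMap.bot_lt_ker_of_det_eq_zero (f := (fderiv ℂ F v : (Fin n → ℂ) →ₗ[ℂ] _)) hdet).ne'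
  have hwker' : fderiv ℂ F v w = 0 := hwker
  obtain ⟨hv0, hFv, e⟩ := h.lift v hv
  obtain ⟨V, Ψ, hFV, hΨ⟩ := hR (F v) hFv
  obtain ⟨j, hj⟩ := Function.ne_iff.mp hv0
  have hFd := h.toIsLift.differentiableAt hv
  have hcomp : HasFDerivAt (fun x => Ψ (F x)) ((fderiv ℂ Ψ (F v)).comp (fderiv ℂ F v)) v :=
    (hΨ.differentiableAt hFV).hasFDerivAt.comp v hFd.hasFDerivAt
  have hcd : DifferentiableAt ℂ (fun x => Ψ (F x) j / x j) v := by
    have h1 : DifferentiableAt ℂ (fun x : Fin n → ℂ => x j) v := by fun_prop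
    simp only [div_eq_mul_inv]
    exact (differentiableAt_pi.mp hcomp.differentiableAt j).mul (h1.inv hj)
  have hprop : ∀ x ∈ U, F x ∈ V → ∃ a : ℂ, a ≠ 0 ∧ Ψ (F x) = a • x := by
    intro x hx hxV
    obtain ⟨hx0, hFx, e⟩ := h.lift x hx
    obtain ⟨hF0, hΨ0, e'⟩ := hΨ.lift _ hxV
    rw [← e, hRS] at e'
    obtain ⟨a, ha⟩ := (Projectivization.mk_eq_mk_iff' ℂ _ _ _ _).mp e'.symm
    exact ⟨a, fun h => hΨ0 (by rw [← ha, h, zero_smul]), ha.symm⟩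
  have heq : ∀ᶠ x in 𝓝 v, Ψ (F x) = (Ψ (F x) j / x j) • x := by
    have hcj : ContinuousAt (fun x : Fin n → ℂ => x j) v := (continuous_apply j).continuousAt
    filter_upwards [h.isOpen.mem_nhds hv, hFd.continuousAt (hΨ.isOpen.mem_nhds hFV),
      hcj (isOpen_compl_singleton.mem_nhds hj)] with x hx hx' hxj
    obtain ⟨a, -, ha⟩ := hprop x hx hx'
    have hxj' : x j ≠ 0 := hxj
    rw [ha]
    simp [hxj']
  have h2 : HasFDerivAt (fun x => (Ψ (F x) j / x j) • x)
      ((Ψ (F v) j / v j) • ContinuousLinearMap.id ℂ _ +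
        (fderiv ℂ (fun x => Ψ (F x) j / x j) v).smulRight v) v :=
    hcd.hasFDerivAt.smul (hasFDerivAt_id v)
  have h3 := congrArg (fun L : (Fin n → ℂ) →L[ℂ] (Fin n → ℂ) => L w)
    (hcomp.unique (h2.congr_of_eventuallyEq heq))
  simp only [ContinuousLinearMap.comp_apply, hwker', map_zero, add_apply,
    smul_apply, ContinuousLinearMap.id_apply,
    ContinuousLinearMap.smulRight_apply] at h3
  obtain ⟨a, ha0, ha⟩ := hprop v hv hFV
  have hcv : Ψ (F v) j / v j = a := by
    have : v j ≠ 0 := hj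
    rw [ha]; simp [this]
  rw [hcv] at h3
  set b := fderiv ℂ (fun x => Ψ (F x) j / x j) v w
  have hwv : w = (-(a⁻¹ * b)) • v := by
    have h4 : a • w = -(b • v) := eq_neg_of_add_eq_zero_left h3.symm
    rw [neg_smul, mul_smul, ← smul_neg, ← h4, smul_smul, inv_mul_cancel₀ ha0, one_smul]
  rw [hwv, map_smul, h.fderiv_apply_self hv] at hwker'
  rcases smul_eq_zero.mp hwker' with h5 | h5
  · exact hw (by rw [hwv, h5, zero_smul])
  · exact hFv h5

theorem IsLift.differentiableOn_det (h : IsLift S U F) :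
    DifferentiableOn ℂ (fun x => (fderiv ℂ F x).det) U := by
  have h1 : ∀ x, (fderiv ℂ F x).det
      = ∑ σ : Equiv.Perm (Fin n), (Equiv.Perm.sign σ : ℂ) *
        ∏ i, fderiv ℂ F x (Pi.single i 1) (σ i) := by
    intro x
    rw [ContinuousLinearMap.det, ← LinearMap.det_toMatrix', Matrix.det_apply']
    simp [LinearMap.toMatrix'_apply]
  simp only [h1]
  have h2 : ∀ i j, DifferentiableOn ℂ (fun x => fderiv ℂ F x (Pi.single i 1) j) U := fun i j =>
    differentiableOn_pi.mp
      (differentiableOn_fderiv_apply h.isOpen h.differentiableOn (Pi.single i 1)) j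
  refine DifferentiableOn.fun_sum fun σ _ => DifferentiableOn.const_mul ?_ _
  intro x hx
  exact (HasFDerivWithinAt.finsetProd fun i _ => (h2 i (σ i) x hx).hasFDerivWithinAt).differentiableWithinAt

/-- A homogeneous lift is multiplied by a local `n`-th root `u` of the inverse of its Jacobian `δ`.
As `δ` has degree zero, so does `u`, and the new Jacobian is `uⁿ δ = 1`. -/
theorem IsHolomorphicMap.exists_unimodular (hS : IsHolomorphicMap S) (hR : IsHolomorphicMap R)
    (hRS : Function.LeftInverse R S) {v : Fin n → ℂ} (hv : v ≠ 0) :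
    ∃ U F, v ∈ U ∧ IsUnimodularLift S U F := by
  obtain ⟨U₀, F₀, hv₀, h₀⟩ := hS v hv
  obtain ⟨U, F, hvU, h⟩ := h₀.exists_homogeneous hv₀
  have hn : n ≠ 0 := by
    rintro rfl
    exact hv (Subsingleton.elim _ _)
  set δ : (Fin n → ℂ) → ℂ := fun x => (fderiv ℂ F x).det
  have hδ : DifferentiableOn ℂ δ U := h.toIsLift.differentiableOn_det
  have hδ0 : ∀ x ∈ U, δ x ≠ 0 := fun x hx => h.det_ne_zero hR hRS hx
  obtain ⟨κ, hκ⟩ := IsAlgClosed.exists_pow_nat_eq (δ v)⁻¹ (Nat.pos_of_ne_zero hn)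
  have hκ0 : κ ≠ 0 := by
    rintro rfl
    rw [zero_pow hn] at hκ
    exact inv_ne_zero (hδ0 v hvU) hκ.symm
  -- On `V` the principal logarithm of `δ x / δ v` is holomorphic; `κ` supplies the root at `v`
  -- itself.
  set V : Set (Fin n → ℂ) := U ∩ (fun x => δ x / δ v) ⁻¹' Complex.slitPlane
  have hdiv : DifferentiableOn ℂ (fun x => δ x / δ v) U :=
    differentiableOn_fun_div hδ (differentiableOn_const _) fun _ _ => hδ0 v hvU
  have hV : IsOpen V :=
    hdiv.continuousOn.isOpen_inter_preimage h.isOpen Complex.isOpen_slitPlane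
  have hVU : V ⊆ U := Set.inter_subset_left
  set u : (Fin n → ℂ) → ℂ := fun x => κ * Complex.exp (-(Complex.log (δ x / δ v) / n))
  have hu : DifferentiableOn ℂ u V :=
    (differentiableOn_fun_div ((hdiv.mono hVU).clog fun x hx => hx.2)
      (differentiableOn_const _) fun _ _ => by exact_mod_cast hn).neg.cexp.const_mul κ
  have hu0 : ∀ x, u x ≠ 0 := fun x => mul_ne_zero hκ0 (Complex.exp_ne_zero _)
  have hun : ∀ x ∈ V, u x ^ n = (δ x)⁻¹ := by
    intro x hx
    have h1 : δ x / δ v ≠ 0 := div_ne_zero (hδ0 x hx.1) (hδ0 v hvU)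
    have h2 : (n : ℂ) ≠ 0 := by exact_mod_cast hn
    simp only [u]
    rw [mul_pow, hκ, ← Complex.exp_nat_mul, mul_neg, mul_div_cancel₀ _ h2, Complex.exp_neg,
      Complex.exp_log h1, inv_div, ← mul_div_assoc, inv_mul_cancel₀ (hδ0 v hvU), one_div]
  have huinv : ∀ x ∈ V, ∀ c : ℂ, c • x ∈ V → u (c • x) = u x := by
    intro x hx c hcx
    have hc : c ≠ 0 := by
      rintro rfl
      obtain ⟨h1, -⟩ := h.lift _ (hVU hcx)
      simp at h1
    simp only [u, δ]
    rw [fderiv_smul_eq_of_homogeneous h.isOpen h.differentiableOn h.homogeneous (hVU hx) hc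
      (hVU hcx)]
  have hvV : v ∈ V := ⟨hvU, by simp [hδ0 v hvU]⟩
  refine ⟨V, fun x => u x • F x, hvV, (h.mono hV hVU).smul hu (fun x _ => hu0 x) huinv, ?_⟩
  intro x hx
  rw [det_fderiv_smul (h.toIsLift.differentiableAt (hVU hx)) (hu.differentiableAt (hV.mem_nhds hx))
    (h.fderiv_apply_self (hVU hx)) (fderiv_apply_self_of_invariant hV hu huinv hx) (hu0 x)]
  rw [Module.finrank_fin_fun, hun x hx]
  exact inv_mul_cancel₀ (hδ0 x (hVU hx))

/-- The ratio of the two lifts has degree zero, and comparing Jacobians makes its `n`-th power `1`.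
Being continuous it is locally constant, so it passes through the derivative. -/
theorem IsUnimodularLift.fderiv_unique (h : IsUnimodularLift S U F)
    (h' : IsUnimodularLift S U' F') {v : Fin n → ℂ} (hv : v ∈ U) (hv' : v ∈ U') :
    ∃ ζ : ℂ, ζ ^ n = 1 ∧ fderiv ℂ F' v = ζ • fderiv ℂ F v := by
  obtain ⟨hv0, hFv, -⟩ := h.lift v hv
  have hn : n ≠ 0 := by
    rintro rfl
    exact hv0 (Subsingleton.elim _ _)
  obtain ⟨i, hi⟩ := Function.ne_iff.mp hFv
  have hFi : DifferentiableOn ℂ (fun x => F x i) U := differentiableOn_pi.mp h.differentiableOn i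
  have hFi' : DifferentiableOn ℂ (fun x => F' x i) U' :=
    differentiableOn_pi.mp h'.differentiableOn i
  set V : Set (Fin n → ℂ) := (U ∩ (fun x => F x i) ⁻¹' {0}ᶜ) ∩ U'
  have hV : IsOpen V := (hFi.continuousOn.isOpen_inter_preimage h.isOpen
    isOpen_compl_singleton).inter h'.isOpen
  have hVU : V ⊆ U := fun x hx => hx.1.1
  have hVU' : V ⊆ U' := fun x hx => hx.2
  set u : (Fin n → ℂ) → ℂ := fun x => F' x i / F x i
  have hu : DifferentiableOn ℂ u V := 
    differentiableOn_fun_div (hFi'.mono hVU') (hFi.mono hVU) fun x hx => hx.1.2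
  have hFF' : ∀ x ∈ V, u x ≠ 0 ∧ F' x = u x • F x := by
    intro x hx
    have h1 : F x i ≠ 0 := hx.1.2
    obtain ⟨a, ha, e⟩ := h.toIsLift.exists_smul_eq h'.toIsLift (c := 1) (hVU hx)
      (by simpa using hVU' hx)
    rw [one_smul] at e
    have h2 : u x = a := by simp only [u]; rw [e]; simp [h1]
    rw [h2]
    exact ⟨ha, e⟩
  have huinv : ∀ x ∈ V, ∀ c : ℂ, c • x ∈ V → u (c • x) = u x := by
    intro x hx c hcx
    have hc : c ≠ 0 := by
      rintro rfl
      obtain ⟨h1, -⟩ := h.lift _ (hVU hcx)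
      simp at h1
    simp only [u]
    rw [h.homogeneous x (hVU hx) c (hVU hcx), h'.homogeneous x (hVU' hx) c (hVU' hcx)]
    simp only [Pi.smul_apply, smul_eq_mul]
    rw [mul_div_mul_left _ _ hc]
  have hun : ∀ x ∈ V, u x ^ n = 1 := by
    intro x hx
    have h1 : F' =ᶠ[𝓝 x] fun y => u y • F y :=
      Filter.eventually_of_mem (hV.mem_nhds hx) fun y hy => (hFF' y hy).2
    have h2 := det_fderiv_smul (h.toIsLift.differentiableAt (hVU hx))
      (hu.differentiableAt (hV.mem_nhds hx)) (h.fderiv_apply_self (hVU hx))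
      (fderiv_apply_self_of_invariant hV hu huinv hx) (hFF' x hx).1
    rw [← h1.fderiv_eq, h.det_eq_one x (hVU hx), h'.det_eq_one x (hVU' hx),
      Module.finrank_fin_fun, mul_one] at h2
    exact h2.symm
  have hvV : v ∈ V := ⟨⟨hv, hi⟩, hv'⟩
  have hconst : ∀ᶠ x in 𝓝 v, u x = u v :=
    eventually_eq_of_mem_finite (finite_setOf_pow_eq hn 1)
      (hu.differentiableAt (hV.mem_nhds hvV)).continuousAt
      (Filter.eventually_of_mem (hV.mem_nhds hvV) hun)
  have heq : F' =ᶠ[𝓝 v] fun x => u v • F x := by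
    filter_upwards [hconst, hV.mem_nhds hvV] with x hx hxV
    rw [← hx]
    exact (hFF' x hxV).2
  refine ⟨u v, hun v hvV, ?_⟩
  rw [heq.fderiv_eq]
  exact ((h.toIsLift.differentiableAt hv).hasFDerivAt.const_smul (u v)).fderiv

/-- Scaling by `c` acts trivially on projective space. Lifts near `c • v` can thus be carried to `v`
and compared with lifts there. -/
theorem IsUnimodularLift.rescale (h : IsUnimodularLift S U F) {c : ℂ} (hc : c ≠ 0) :
    IsUnimodularLift S ((fun x => c • x) ⁻¹' U) (fun x => c⁻¹ • F (c • x)) ∧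
      ∀ x, c • x ∈ U → fderiv ℂ (fun x => c⁻¹ • F (c • x)) x = fderiv ℂ F (c • x) := by
  have hfd : ∀ x, c • x ∈ U →
      HasFDerivAt (fun x => c⁻¹ • F (c • x)) (fderiv ℂ F (c • x)) x := by
    intro x hx
    have h1 : HasFDerivAt (fun x : Fin n → ℂ => c • x) (c • ContinuousLinearMap.id ℂ _) x :=
      (hasFDerivAt_id x).const_smul c
    have h2 := ((h.toIsLift.differentiableAt hx).hasFDerivAt.comp x h1).const_smul c⁻¹
    simpa [smul_smul, inv_mul_cancel₀ hc] using h2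
  refine ⟨⟨⟨⟨h.isOpen.preimage (by fun_prop),
    fun x hx => (hfd x hx).differentiableAt.differentiableWithinAt, ?_⟩, ?_⟩, ?_⟩,
    fun x hx => (hfd x hx).fderiv⟩
  · intro x hx
    obtain ⟨h0, hF, e⟩ := h.lift _ hx
    have hx0 : x ≠ 0 := fun hx0 => h0 (by simp [hx0])
    refine ⟨hx0, smul_ne_zero (inv_ne_zero hc) hF, ?_⟩
    have h1 : Projectivization.mk ℂ (c • x) h0 = Projectivization.mk ℂ x hx0 :=
      (Projectivization.mk_eq_mk_iff' ℂ _ _ _ _).mpr ⟨c, rfl⟩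
    rw [← h1, e]
    exact ((Projectivization.mk_eq_mk_iff' ℂ _ _ _ _).mpr ⟨c⁻¹, rfl⟩).symm
  · intro x hx a hax
    have h1 : a • c • x ∈ U := by rw [smul_comm]; exact hax
    rw [smul_comm c a x, h.homogeneous _ hx a h1, smul_comm]
  · intro x hx
    rw [(hfd x hx).fderiv]
    exact h.det_eq_one _ hx

theorem IsUnimodularLift.fderiv_unique_smul (h : IsUnimodularLift S U F)
    (h' : IsUnimodularLift S U' F') {v : Fin n → ℂ} {c : ℂ} (hv : v ∈ U) (hv' : c • v ∈ U') :
    ∃ ζ : ℂ, ζ ^ n = 1 ∧ fderiv ℂ F' (c • v) = ζ • fderiv ℂ F v := by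
  have hc : c ≠ 0 := by
    rintro rfl
    obtain ⟨h1, -⟩ := h'.lift _ hv'
    simp at h1
  obtain ⟨h1, h2⟩ := h'.rescale hc
  obtain ⟨ζ, hζ, e⟩ := h.fderiv_unique h1 hv hv'
  exact ⟨ζ, hζ, by rw [← h2 v hv', e]⟩

theorem IsUnimodularLift.pow_fderiv_eq (h : IsUnimodularLift S U F)
    (h' : IsUnimodularLift S U' F') {v : Fin n → ℂ} {c : ℂ} (hv : v ∈ U) (hv' : c • v ∈ U')
    (i j : Fin n) :
    (fderiv ℂ F' (c • v) (Pi.single i 1) j) ^ n = (fderiv ℂ F v (Pi.single i 1) j) ^ n := by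
  obtain ⟨ζ, hζ, e⟩ := h.fderiv_unique_smul h' hv hv'
  rw [e]
  simp [mul_pow, hζ]

/-- The `n`-th powers of the partial derivatives of unimodular lifts are all equal. -/
theorem exists_pow_fderiv_eq (hS : ∀ v : Fin n → ℂ, v ≠ 0 → ∃ U F, v ∈ U ∧ IsUnimodularLift S U F)
    (i j : Fin n) : ∃ κ : ℂ, ∀ U F, IsUnimodularLift S U F → ∀ v ∈ U,
      (fderiv ℂ F v (Pi.single i 1) j) ^ n = κ := by
  classical
  choose! V Φ hV hΦ using hS
  set P : (Fin n → ℂ) → ℂ := fun v => (fderiv ℂ (Φ v) v (Pi.single i 1) j) ^ n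
  -- The chosen lift jumps with the point, but the `n`-th power forgets the root of unity: near `v`,
  -- `P` is computed by the single lift `Φ v`.
  have hP : ∀ v, v ≠ 0 → DifferentiableAt ℂ P v := by
    intro v hv
    have h := hΦ v hv
    have h1 : DifferentiableAt ℂ (fun x => (fderiv ℂ (Φ v) x (Pi.single i 1) j) ^ n) v :=
      ((differentiableOn_pi.mp (differentiableOn_fderiv_apply h.isOpen h.differentiableOn
        (Pi.single i 1)) j).differentiableAt (h.isOpen.mem_nhds (hV v hv))).pow n
    refine h1.congr_of_eventuallyEq ?_
    filter_upwards [h.isOpen.mem_nhds (hV v hv)] with x hx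
    obtain ⟨hx0, -⟩ := h.lift x hx
    simpa using h.pow_fderiv_eq (hΦ x hx0) (c := 1) hx (by simpa using hV x hx0) i j
  have hinv : ∀ (c : ℂ) (v : Fin n → ℂ), c ≠ 0 → v ≠ 0 → P (c • v) = P v := fun c v hc hv =>
    (hΦ v hv).pow_fderiv_eq (hΦ _ (smul_ne_zero hc hv)) (hV v hv) (hV _ (smul_ne_zero hc hv)) i j
  have hei : (Pi.single i 1 : Fin n → ℂ) ≠ 0 := by simp
  refine ⟨P (Pi.single i 1), fun U F h v hv => ?_⟩
  obtain ⟨hv0, -⟩ := h.lift v hv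
  rw [← eq_of_differentiableAt_of_smul_invariant hP hinv hv0 hei]
  simpa using (hΦ v hv0).pow_fderiv_eq h (c := 1) (hV v hv0) (by simpa using hv) i j

/-- Each entry of `DF` has a constant `n`-th power, so it is locally constant. Euler's identity `F x
= DF_x x` then makes `F` linear near `v`. -/
theorem IsUnimodularLift.eventually_eq_linear
    (hS : ∀ v : Fin n → ℂ, v ≠ 0 → ∃ U F, v ∈ U ∧ IsUnimodularLift S U F)
    (h : IsUnimodularLift S U F) {v : Fin n → ℂ} (hv : v ∈ U) :
    ∀ᶠ x in 𝓝 v, F x = fderiv ℂ F v x := by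
  have hn : n ≠ 0 := by
    rintro rfl
    obtain ⟨h0, -⟩ := h.lift v hv
    exact h0 (Subsingleton.elim _ _)
  have h1 : ∀ i j, ∀ᶠ x in 𝓝 v,
      fderiv ℂ F x (Pi.single i 1) j = fderiv ℂ F v (Pi.single i 1) j := by
    intro i j
    obtain ⟨κ, hκ⟩ := exists_pow_fderiv_eq hS i j
    refine eventually_eq_of_mem_finite (f := fun x => fderiv ℂ F x (Pi.single i 1) j)
      (finite_setOf_pow_eq hn κ) ?_
      (Filter.eventually_of_mem (h.isOpen.mem_nhds hv) fun x hx => hκ U F h x hx)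
    exact ((differentiableOn_pi.mp (differentiableOn_fderiv_apply h.isOpen h.differentiableOn
        (Pi.single i 1)) j).differentiableAt (h.isOpen.mem_nhds hv)).continuousAt
  have h2 : ∀ᶠ x in 𝓝 v, ∀ i j,
      fderiv ℂ F x (Pi.single i 1) j = fderiv ℂ F v (Pi.single i 1) j :=
    Filter.eventually_all.mpr fun i => Filter.eventually_all.mpr fun j => h1 i j
  filter_upwards [h2, h.isOpen.mem_nhds hv] with x hx hxU
  have h3 : (fderiv ℂ F x : (Fin n → ℂ) →ₗ[ℂ] (Fin n → ℂ)) = fderiv ℂ F v := by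
    refine LinearMap.pi_ext' fun i => LinearMap.ext_ring ?_
    ext j
    exact hx i j
  rw [← h.fderiv_apply_self hxU]
  exact LinearMap.congr_fun h3 x

/-- A holomorphic self-map of `ℙ(ℂⁿ)` with a holomorphic left inverse is induced by a linear
map. -/
theorem IsHolomorphicMap.exists_linear (hS : IsHolomorphicMap S) (hR : IsHolomorphicMap R)
    (hRS : Function.LeftInverse R S) :
    ∃ A : (Fin n → ℂ) →ₗ[ℂ] (Fin n → ℂ), ∀ (v : Fin n → ℂ) (hv : v ≠ 0), ∃ hA : A v ≠ 0,
      S (Projectivization.mk ℂ v hv) = Projectivization.mk ℂ (A v) hA := by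
  have hS' : ∀ v : Fin n → ℂ, v ≠ 0 → ∃ U F, v ∈ U ∧ IsUnimodularLift S U F :=
    fun v hv => hS.exists_unimodular hR hRS hv
  have hloc : ∀ v : Fin n → ℂ, v ≠ 0 → ∃ A : (Fin n → ℂ) →L[ℂ] (Fin n → ℂ), ∃ U,
      v ∈ U ∧ IsUnimodularLift S U A := by
    intro v hv
    obtain ⟨U, F, hvU, h⟩ := hS' v hv
    obtain ⟨V, hV, hVo, hvV⟩ := eventually_nhds_iff.mp
      ((h.eventually_eq_linear hS' hvU).and (h.isOpen.mem_nhds hvU))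
    refine ⟨fderiv ℂ F v, V, hvV, ⟨⟨⟨hVo, by fun_prop, fun x hx => ?_⟩, fun x _ c _ => by simp⟩,
      fun x _ => ?_⟩⟩
    · rw [← (hV x hx).1]
      exact h.lift x (hV x hx).2
    · rw [ContinuousLinearMap.fderiv]
      exact h.det_eq_one v hvU
  -- `Q x y` says that one linear map lifts `S` near both `x` and `y`. It spreads over `ℂⁿ ∖ {0}`,
  -- which is connected because its real dimension is `2n ≥ 2`.
  let Q : (Fin n → ℂ) → (Fin n → ℂ) → Prop := fun x y =>
    ∃ A : (Fin n → ℂ) →L[ℂ] (Fin n → ℂ), ∃ U V, x ∈ U ∧ IsUnimodularLift S U A ∧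
      y ∈ V ∧ IsUnimodularLift S V A
  have hQ : ∀ x y : Fin n → ℂ, x ≠ 0 → y ≠ 0 → Q x y := by
    intro x y hx hy
    have hn : 0 < n := by
      rcases Nat.eq_zero_or_pos n with rfl | h
      · exact absurd (Subsingleton.elim _ _) hx
      · exact h
    have hrank : 1 < Module.rank ℝ (Fin n → ℂ) := by
      rw [← Module.finrank_eq_rank, ← Module.finrank_mul_finrank ℝ ℂ (Fin n → ℂ)]
      simp only [Complex.finrank_real_complex, Module.finrank_fin_fun]
      exact_mod_cast (by omega : 1 < 2 * n)
    refine (isConnected_compl_singleton_of_one_lt_rank hrank 0).isPreconnected.induction₂' Q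
      ?_ ?_ hx hy
    · intro z hz
      obtain ⟨A, U, hzU, h⟩ := hloc z hz
      filter_upwards [mem_nhdsWithin_of_mem_nhds (h.isOpen.mem_nhds hzU)] with w hw
      exact ⟨⟨A, U, U, hzU, h, hw, h⟩, ⟨A, U, U, hw, h, hzU, h⟩⟩
    -- Transitivity: the two linear lifts available at `b` differ by a root of unity, so the first
    -- one is also a lift near `c`.
    · rintro a b c - - - ⟨A, U, V, haU, hU, hbV, hV⟩ ⟨B, U', V', hbU', hU', hcV', hV'⟩
      obtain ⟨ζ, hζ, e⟩ := hU'.fderiv_unique hV hbU' hbV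
      rw [ContinuousLinearMap.fderiv, ContinuousLinearMap.fderiv] at e
      have hζ0 : ζ ≠ 0 := by
        rintro rfl
        rw [zero_pow hn.ne'] at hζ
        exact zero_ne_one hζ
      refine ⟨A, U, V', haU, hU, hcV', ⟨⟨⟨hV'.isOpen, by fun_prop, fun x hx => ?_⟩,
        fun x _ c _ => by simp⟩, fun x hx => ?_⟩⟩
      · rw [e]
        exact (hV'.toIsLift.smul (differentiableOn_const ζ) fun _ _ => hζ0).lift x hx
      · rw [ContinuousLinearMap.fderiv]
        have := hV.det_eq_one b hbV
        rwa [ContinuousLinearMap.fderiv] at this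
  by_cases hex : ∃ v₀ : Fin n → ℂ, v₀ ≠ 0
  · obtain ⟨v₀, hv₀⟩ := hex
    obtain ⟨A, U, hvU, hA⟩ := hloc v₀ hv₀
    have hn : n ≠ 0 := by
      rintro rfl
      exact hv₀ (Subsingleton.elim _ _)
    refine ⟨A, fun v hv => ?_⟩
    obtain ⟨B, U', V', hU', hBU', hV', hBV'⟩ := hQ v₀ v hv₀ hv
    obtain ⟨ζ, hζ, e⟩ := hBU'.fderiv_unique hA hU' hvU
    rw [ContinuousLinearMap.fderiv, ContinuousLinearMap.fderiv] at e
    have hζ0 : ζ ≠ 0 := by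
      rintro rfl
      rw [zero_pow hn] at hζ
      exact zero_ne_one hζ
    obtain ⟨_, hF, e'⟩ := (hBV'.toIsLift.smul (differentiableOn_const ζ) fun _ _ => hζ0).lift v hV'
    rw [e]
    exact ⟨hF, e'⟩
  · exact ⟨0, fun v hv => absurd ⟨v, hv⟩ hex⟩

end ProjectiveMaps

/-! ### From invariance under a real form to invariance under the complex group -/

section InvariantSubspaces

variable {H : Type*} [Group H] {n : ℕ}

/-- The operator `ρ(h)` on `ℂⁿ`, as a continuous linear map. -/
def repCLM (ρ : H →* Matrix.SpecialLinearGroup (Fin n) ℂ) (h : H) :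
    (Fin n → ℂ) →L[ℂ] (Fin n → ℂ) :=
  LinearMap.toContinuousLinearMap (Matrix.toLin' (ρ h).1)

variable {ρ : H →* Matrix.SpecialLinearGroup (Fin n) ℂ}

theorem repCLM_apply (h : H) (v : Fin n → ℂ) : repCLM ρ h v = (ρ h).1 *ᵥ v := by
  simp [repCLM]

theorem complexRep_apply (h : H) (v : Fin n → ℂ) : complexRep ρ h v = (ρ h).1 *ᵥ v := rfl

theorem repCLM_mul (a b : H) : repCLM ρ (a * b) = (repCLM ρ a).comp (repCLM ρ b) := by
  ext v i
  simp [repCLM_apply]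

theorem repCLM_one : repCLM ρ (1 : H) = ContinuousLinearMap.id ℂ _ := by
  ext v i
  simp [repCLM_apply]

theorem repCLM_inv_comp (a : H) :
    (repCLM ρ a).comp (repCLM ρ a⁻¹) = ContinuousLinearMap.id ℂ _ := by
  rw [← repCLM_mul, mul_inv_cancel, repCLM_one]

theorem repCLM_apply_ne_zero (h : H) {v : Fin n → ℂ} (hv : v ≠ 0) : repCLM ρ h v ≠ 0 := by
  intro h0
  have h1 := congrArg (fun L : (Fin n → ℂ) →L[ℂ] (Fin n → ℂ) => L v) (repCLM_inv_comp (ρ := ρ) h⁻¹)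
  simp only [inv_inv, ContinuousLinearMap.comp_apply, h0, map_zero,
    ContinuousLinearMap.id_apply] at h1
  exact hv h1.symm

theorem repCLM_eq_sum (h : H) : repCLM ρ h = ∑ i, ∑ j, (ρ h).1 i j •
    (ContinuousLinearMap.proj (R := ℂ) (φ := fun _ : Fin n => ℂ) j).smulRight
      (Pi.single i 1 : Fin n → ℂ) := by
  ext v k
  simp [repCLM_apply, Matrix.mulVec, dotProduct, Finset.sum_apply, Pi.single_apply]

variable {E : Type*} [NormedAddCommGroup E] [NormedSpace ℂ E]
  [TopologicalSpace H] [ChartedSpace E H]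

theorem IsHolomorphicRep.continuous (hρ : IsHolomorphicRep (E := E) ρ) :
    Continuous (repCLM ρ : H → _) := by
  have h : (repCLM ρ : H → _) = fun h => ∑ i, ∑ j, (ρ h).1 i j •
    (ContinuousLinearMap.proj (R := ℂ) (φ := fun _ : Fin n => ℂ) j).smulRight
      (Pi.single i 1 : Fin n → ℂ) := funext repCLM_eq_sum
  rw [h]
  exact continuous_finsetSum _ fun i _ => continuous_finsetSum _ fun j _ =>
    (hρ i j).continuous.smul continuous_const

theorem IsHolomorphicRep.differentiableAt_chart [IsManifold 𝓘(ℂ, E) 1 H]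
    (hρ : IsHolomorphicRep (E := E) ρ)
    {y : E} (hy : y ∈ (chartAt E (1 : H)).target) :
    DifferentiableAt ℂ (fun y => repCLM ρ ((chartAt E (1 : H)).symm y)) y := by
  simp only [repCLM_eq_sum]
  refine DifferentiableAt.fun_sum fun i _ => DifferentiableAt.fun_sum fun j _ =>
    DifferentiableAt.smul_const ?_ _
  exact ((hρ i j _).comp y (mdifferentiableAt_atlas_symm (I := 𝓘(ℂ, E))
    (chart_mem_atlas E (1 : H)) hy)).differentiableAt

/-- The derivative at `1` of the representation, read in the preferred chart. -/
def repDeriv (E : Type*) [NormedAddCommGroup E] [NormedSpace ℂ E] [ChartedSpace E H]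
    (ρ : H →* Matrix.SpecialLinearGroup (Fin n) ℂ) :
    E →L[ℂ] ((Fin n → ℂ) →L[ℂ] (Fin n → ℂ)) :=
  fderiv ℂ (fun y => repCLM ρ ((chartAt E (1 : H)).symm y)) (chartAt E (1 : H) 1)

/-- The curve `ρ(γ t) w` stays in `W`, so a linear map with kernel `W` kills its velocity at `0`. -/
theorem repDeriv_apply_mem_of_mem_lieAlgebraOf [IsManifold 𝓘(ℂ, E) 1 H]
    (hρ : IsHolomorphicRep (E := E) ρ)
    {G : Subgroup H} {W : Submodule ℂ (Fin n → ℂ)}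
    (hW : ∀ g ∈ G, ∀ w ∈ W, repCLM ρ g w ∈ W) {X : E}
    (hX : X ∈ lieAlgebraOf (E := E) G) {w : Fin n → ℂ} (hw : w ∈ W) :
    repDeriv E ρ X w ∈ W := by
  obtain ⟨γ, h0, -, hG, hc, hd⟩ := hX
  have hd' : HasDerivAt (fun t => chartAt E (1 : H) (γ t)) X 0 := by
    have h1 : HasFDerivAt (fun t => chartAt E (1 : H) (γ t))
        (ContinuousLinearMap.toSpanSingleton ℝ X) (0 : ℝ) := by
      have h2 : HasFDerivWithinAt (fun t => chartAt E (γ 0) (γ t))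
        (ContinuousLinearMap.toSpanSingleton ℝ X) (Set.range (id : ℝ → ℝ)) (0 : ℝ) := hd
      rwa [Set.range_id, h0, hasFDerivWithinAt_univ] at h2
    simpa using h1.hasDerivAt
  have hf : HasFDerivAt (fun y => repCLM ρ ((chartAt E (1 : H)).symm y)) (repDeriv E ρ)
      (chartAt E (1 : H) (γ 0)) := by
    rw [h0]
    exact (hρ.differentiableAt_chart (mem_chart_target E 1)).hasFDerivAt
  have h1 : HasDerivAt (fun t => repCLM ρ (γ t)) (repDeriv E ρ X) 0 := by
    refine ((hf.restrictScalars ℝ).comp_hasDerivAt 0 hd').congr_of_eventuallyEq ?_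
    have : ∀ᶠ t in 𝓝 (0 : ℝ), γ t ∈ (chartAt E (1 : H)).source :=
      hc (by rw [h0]; exact chart_source_mem_nhds E 1)
    filter_upwards [this] with t ht
    simp [(chartAt E (1 : H)).left_inv ht]
  have h2 : HasDerivAt (fun t => repCLM ρ (γ t) w) (repDeriv E ρ X w) 0 := by
    have := (((ContinuousLinearMap.apply ℂ (Fin n → ℂ) w).hasFDerivAt
      (x := repCLM ρ (γ 0))).restrictScalars ℝ).comp_hasDerivAt 0 h1
    simpa using! this
  obtain ⟨p, hp⟩ := W.subtype.exists_leftInverse_of_injective W.ker_subtype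
  have hpW : ∀ v ∈ W, (p v : Fin n → ℂ) = v := fun v hv => by
    have := LinearMap.congr_fun hp ⟨v, hv⟩
    simpa using congrArg Subtype.val this
  set Pr : (Fin n → ℂ) →L[ℂ] (Fin n → ℂ) :=
    LinearMap.toContinuousLinearMap (LinearMap.id - W.subtype ∘ₗ p)
  have hPr : ∀ v, v ∈ W ↔ Pr v = 0 := by
    intro v
    simp only [Pr, LinearMap.coe_toContinuousLinearMap', LinearMap.sub_apply, LinearMap.id_apply,
      LinearMap.comp_apply, Submodule.subtype_apply, sub_eq_zero]
    exact ⟨fun hv => (hpW v hv).symm, fun hv => hv ▸ (p v).2⟩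
  have h3 : HasDerivAt (fun t => Pr (repCLM ρ (γ t) w)) (Pr (repDeriv E ρ X w)) 0 :=
    (Pr.hasFDerivAt.restrictScalars ℝ).comp_hasDerivAt 0 h2
  have h4 : (fun t => Pr (repCLM ρ (γ t) w)) = fun _ => 0 :=
    funext fun t => (hPr _).mp (hW _ (hG t) w hw)
  rw [hPr]
  rw [h4] at h3
  exact h3.unique (hasDerivAt_const _ _)

/-- Writing `Z = X + iY` with `X, Y` in `𝔤` suffices: the derivative of `ρ` is complex linear and
`W` is a complex subspace. -/
theorem IsRealForm.repDeriv_apply_mem [IsManifold 𝓘(ℂ, E) 1 H]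
    {G : Subgroup H} (hG : IsRealForm (E := E) G)
    (hρ : IsHolomorphicRep (E := E) ρ) {W : Submodule ℂ (Fin n → ℂ)}
    (hW : ∀ g ∈ G, ∀ w ∈ W, repCLM ρ g w ∈ W) (Z : E) {w : Fin n → ℂ} (hw : w ∈ W) :
    repDeriv E ρ Z w ∈ W := by
  obtain ⟨⟨X, Y⟩, ⟨hX, hY, hZ⟩, -⟩ := hG.decomposition Z
  have hZ' : Z = (show E from X) + Complex.I • (show E from Y) := hZ
  rw [hZ', map_add, map_smul]
  exact W.add_mem (repDeriv_apply_mem_of_mem_lieAlgebraOf hρ hW hX hw)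
    (W.smul_mem _ (repDeriv_apply_mem_of_mem_lieAlgebraOf hρ hW hY hw))

/-- The logarithmic derivative of the representation takes values in the image of `repDeriv`. -/
theorem fderiv_repCLM_eq [LieGroup 𝓘(ℂ, E) ω H] [IsManifold 𝓘(ℂ, E) 1 H]
    (hρ : IsHolomorphicRep (E := E) ρ)
    {y : E} (hy : y ∈ (chartAt E (1 : H)).target) (x : E) :
    ∃ Z : E, fderiv ℂ (fun y => repCLM ρ ((chartAt E (1 : H)).symm y)) y x
      = (repCLM ρ ((chartAt E (1 : H)).symm y)).comp (repDeriv E ρ Z) := by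
  have : IsTopologicalGroup H := topologicalGroup_of_lieGroup 𝓘(ℂ, E) ω
  set φ := chartAt E (1 : H)
  set a : H := φ.symm y
  have hmul : MDifferentiableAt 𝓘(ℂ, E) 𝓘(ℂ, E) (fun h : H => a⁻¹ * h) (φ.symm y) :=
    (contMDiff_mul_left (I := 𝓘(ℂ, E)) (n := ω)).mdifferentiable (by simp) _
  have hsymm : MDifferentiableAt 𝓘(ℂ, E) 𝓘(ℂ, E) φ.symm y :=
    mdifferentiableAt_atlas_symm (chart_mem_atlas E (1 : H)) hy
  have hinner := hmul.comp y hsymm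
  have h1 : a⁻¹ * φ.symm y = 1 := inv_mul_cancel a
  -- Left translation by `a⁻¹` moves the point to `1`: near `y`, `ρ(φ⁻¹ z) = ρ(a) ρ(a⁻¹ φ⁻¹ z)`. The
  -- chain rule gives the claim, with `Z` the derivative of this translation in the chart.
  have hψ : DifferentiableAt ℂ (fun z => φ (a⁻¹ * φ.symm z)) y := by
    refine (MDifferentiableAt.comp_of_eq (I' := 𝓘(ℂ, E)) y (mdifferentiableAt_atlas
      (I := 𝓘(ℂ, E)) (chart_mem_atlas E (1 : H)) (mem_chart_source E (1 : H))) hinner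
      h1).differentiableAt
  have hψy : φ (a⁻¹ * φ.symm y) = φ 1 := by rw [h1]
  have hf : HasFDerivAt (fun y => repCLM ρ (φ.symm y)) (repDeriv E ρ)
      (φ (a⁻¹ * φ.symm y)) := by
    rw [hψy]
    exact (hρ.differentiableAt_chart (mem_chart_target E 1)).hasFDerivAt
  have h2 := hf.comp y hψ.hasFDerivAt
  have h3 := ((ContinuousLinearMap.compL ℂ (Fin n → ℂ) (Fin n → ℂ) (Fin n → ℂ)
    (repCLM ρ a)).hasFDerivAt).comp y h2
  refine ⟨fderiv ℂ (fun z => φ (a⁻¹ * φ.symm z)) y x, ?_⟩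
  have h4 : (fun y => repCLM ρ (φ.symm y)) =ᶠ[𝓝 y]
      (ContinuousLinearMap.compL ℂ (Fin n → ℂ) (Fin n → ℂ) (Fin n → ℂ) (repCLM ρ a)) ∘
        (fun y => repCLM ρ (φ.symm y)) ∘ fun z => φ (a⁻¹ * φ.symm z) := by
    have hcont : ContinuousAt (fun z => a⁻¹ * φ.symm z) y := hinner.continuousAt
    have h5 : ∀ᶠ z in 𝓝 y, a⁻¹ * φ.symm z ∈ φ.source :=
      hcont (by simp only [h1]; exact chart_source_mem_nhds E 1)
    filter_upwards [h5] with z hz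
    simp only [Function.comp_apply, ContinuousLinearMap.compL_apply, φ.left_inv hz]
    rw [← repCLM_mul, mul_inv_cancel_left]
  rw [h4.fderiv_eq, h3.fderiv]
  rfl

/-- Along a segment in the chart, `ρ` solves a linear equation `g' = g B` with `B` in the image of
`𝔥`, hence preserving `W`. The component of `g` from `W` to a complement solves a homogeneous linear
equation with initial value `0`, and vanishes by Grönwall. -/
theorem eventually_repCLM_apply_mem [FiniteDimensional ℂ E] [LieGroup 𝓘(ℂ, E) ω H]
    [IsManifold 𝓘(ℂ, E) 1 H] (hρ : IsHolomorphicRep (E := E) ρ)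
    {W : Submodule ℂ (Fin n → ℂ)} (hW : ∀ (Z : E), ∀ w ∈ W, repDeriv E ρ Z w ∈ W) :
    ∀ᶠ h in 𝓝 (1 : H), ∀ w ∈ W, repCLM ρ h w ∈ W := by
  have : IsTopologicalGroup H := topologicalGroup_of_lieGroup 𝓘(ℂ, E) ω
  set φ := chartAt E (1 : H)
  obtain ⟨p, hp⟩ := W.subtype.exists_leftInverse_of_injective W.ker_subtype
  have hpW : ∀ v ∈ W, (p v : Fin n → ℂ) = v := fun v hv => by
    have := LinearMap.congr_fun hp ⟨v, hv⟩
    simpa using congrArg Subtype.val this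
  set Q : (Fin n → ℂ) →L[ℂ] (Fin n → ℂ) := LinearMap.toContinuousLinearMap (W.subtype ∘ₗ p)
  set Pr : (Fin n → ℂ) →L[ℂ] (Fin n → ℂ) := ContinuousLinearMap.id ℂ _ - Q
  have hQW : ∀ v, Q v ∈ W := fun v => (p v).2
  have hQ : ∀ v ∈ W, Q v = v := hpW
  have hPr : ∀ v, v ∈ W ↔ Pr v = 0 := by
    intro v
    simp only [Pr, sub_apply, ContinuousLinearMap.id_apply, sub_eq_zero]
    exact ⟨fun hv => (hQ v hv).symm, fun hv => hv ▸ hQW v⟩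
  have hopen : IsOpen φ.target := φ.open_target
  obtain ⟨r, hr, hrφ⟩ := Metric.mem_nhds_iff.mp (hopen.mem_nhds (mem_chart_target E (1 : H)))
  set g : E → ((Fin n → ℂ) →L[ℂ] (Fin n → ℂ)) := fun y => repCLM ρ (φ.symm y)
  have hg : DifferentiableOn ℂ g φ.target := fun y hy =>
    (hρ.differentiableAt_chart hy).differentiableWithinAt
  have hball : ∀ x : E, ‖x‖ < r → ∀ w ∈ W, g (φ 1 + x) w ∈ W := by
    intro x hx
    have hmem : ∀ t ∈ Set.Icc (0 : ℝ) 1, φ 1 + (t : ℂ) • x ∈ φ.target := by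
      intro t ht
      apply hrφ
      rw [mem_ball_iff_norm, add_sub_cancel_left, norm_smul, Complex.norm_real, Real.norm_eq_abs,
        abs_of_nonneg ht.1]
      exact (mul_le_of_le_one_left (norm_nonneg x) ht.2).trans_lt hx
    set c : ℝ → E := fun t => φ 1 + (t : ℂ) • x
    have hc : Continuous c := by fun_prop
    set B : ℝ → ((Fin n → ℂ) →L[ℂ] (Fin n → ℂ)) := fun t =>
      (repCLM ρ (φ.symm (c t))⁻¹).comp (fderiv ℂ g (c t) x)
    have hB : ContinuousOn B (Set.Icc 0 1) := by
      have h1 : ContinuousOn (fun t => φ.symm (c t)) (Set.Icc 0 1) :=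
        φ.continuousOn_symm.comp hc.continuousOn hmem
      have h2 : ContinuousOn (fun t => fderiv ℂ g (c t) x) (Set.Icc 0 1) :=
        (differentiableOn_fderiv_apply hopen hg x).continuousOn.comp hc.continuousOn hmem
      exact (hρ.continuous.comp_continuousOn h1.inv).clm_comp h2
    obtain ⟨K, hK⟩ := isCompact_Icc.exists_bound_of_continuousOn hB
    have hgB : ∀ t ∈ Set.Icc (0 : ℝ) 1, fderiv ℂ g (c t) x = (g (c t)).comp (B t) := by
      intro t ht
      simp only [B, g]
      rw [← ContinuousLinearMap.comp_assoc, repCLM_inv_comp, ContinuousLinearMap.id_comp]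
    have hBW : ∀ t ∈ Set.Icc (0 : ℝ) 1, ∀ w ∈ W, B t w ∈ W := by
      intro t ht w hw
      obtain ⟨Z, hZ⟩ := fderiv_repCLM_eq hρ (hmem t ht) x
      have h1 : B t = repDeriv E ρ Z := by
        simp only [B]
        change (repCLM ρ (φ.symm (c t))⁻¹).comp (fderiv ℂ (fun y => repCLM ρ (φ.symm y)) (c t) x)
          = _
        rw [hZ, ← ContinuousLinearMap.comp_assoc, ← repCLM_mul, inv_mul_cancel, repCLM_one,
          ContinuousLinearMap.id_comp]
      rw [h1]
      exact hW Z w hw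
    set f : ℝ → ((Fin n → ℂ) →L[ℂ] (Fin n → ℂ)) := fun t => Pr.comp ((g (c t)).comp Q)
    have hf : ∀ t ∈ Set.Icc (0 : ℝ) 1, HasDerivAt f ((f t).comp (B t |>.comp Q)) t := by
      intro t ht
      have h1 : HasDerivAt c x t := by
        have := ((Complex.ofRealCLM.hasDerivAt (x := t)).smul_const x).const_add (φ 1)
        convert! this using 1
        simp
      have h2 : HasDerivAt (fun t => g (c t)) (fderiv ℂ g (c t) x) t := by
        have h3 : HasFDerivAt g ((fderiv ℂ g (c t)).restrictScalars ℝ) (c t) :=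
          (hg.differentiableAt (hopen.mem_nhds (hmem t ht))).hasFDerivAt.restrictScalars ℝ
        exact h3.comp_hasDerivAt t h1
      have h3 := (((ContinuousLinearMap.compL ℂ (Fin n → ℂ) (Fin n → ℂ) (Fin n → ℂ)
        Pr).hasFDerivAt.restrictScalars ℝ).comp_hasDerivAt t
        (((ContinuousLinearMap.compL ℂ (Fin n → ℂ) (Fin n → ℂ) (Fin n → ℂ)).flip
          Q).hasFDerivAt.restrictScalars ℝ |>.comp_hasDerivAt t h2))
      -- Since `B t` preserves `W`, `Q B Q = B Q`, so the equation closes up in `f`.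
      have h4 : (f t).comp ((B t).comp Q) = Pr.comp ((fderiv ℂ g (c t) x).comp Q) := by
        rw [hgB t ht]
        ext1 v
        simp only [f, ContinuousLinearMap.comp_apply]
        rw [hQ _ (hBW t ht _ (hQW v))]
      rw [h4]
      exact h3
    have hf0 : ∀ t ∈ Set.Icc (0 : ℝ) 1, f t = 0 := by
      have h0 : f 0 = 0 := by
        have h1 : g (c 0) = ContinuousLinearMap.id ℂ _ := by
          simp only [g, c, Complex.ofReal_zero, zero_smul, add_zero]
          rw [φ.left_inv (mem_chart_source E 1), repCLM_one]
        ext1 v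
        simp only [f, h1, ContinuousLinearMap.comp_apply, ContinuousLinearMap.id_apply, zero_apply]
        exact (hPr _).mp (hQW v)
      intro t ht
      have h1 := norm_le_gronwallBound_of_norm_deriv_right_le (f := f)
        (f' := fun t => (f t).comp ((B t).comp Q)) (δ := 0) (K := K * ‖Q‖) (ε := 0) (a := 0)
        (b := 1) (fun t ht => (hf t ht).continuousAt.continuousWithinAt)
        (fun t ht => (hf t (Set.Ico_subset_Icc_self ht)).hasDerivWithinAt) (by simp [h0])
        (fun t ht => by
          have h2 := hK t (Set.Ico_subset_Icc_self ht)
          calc _ ≤ ‖f t‖ * ‖(B t).comp Q‖ := ContinuousLinearMap.opNorm_comp_le _ _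
            _ ≤ ‖f t‖ * (‖B t‖ * ‖Q‖) := by gcongr; exact ContinuousLinearMap.opNorm_comp_le _ _
            _ ≤ ‖f t‖ * (K * ‖Q‖) := by gcongr
            _ = _ := by ring) t ht
      rw [gronwallBound_ε0] at h1
      simpa using h1
    intro w hw
    have h1 := congrArg (fun L : (Fin n → ℂ) →L[ℂ] (Fin n → ℂ) => L w)
      (hf0 1 (Set.right_mem_Icc.mpr zero_le_one))
    simp only [f, c, ContinuousLinearMap.comp_apply, zero_apply, hQ w hw, Complex.ofReal_one,
      one_smul] at h1
    exact (hPr _).mpr h1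
  have hcont : ContinuousAt φ 1 := φ.continuousAt (mem_chart_source E 1)
  filter_upwards [hcont (Metric.ball_mem_nhds _ hr), chart_source_mem_nhds E (1 : H)]
    with h hh hs w hw
  have h1 := hball (φ h - φ 1) (by rwa [← mem_ball_iff_norm]) w hw
  simpa only [g, add_sub_cancel, φ.left_inv hs] using h1

/-- A complex subspace of `ℂⁿ` invariant under a real form of `H` is invariant under `H`. -/
theorem IsRealForm.repCLM_apply_mem [FiniteDimensional ℂ E] [LieGroup 𝓘(ℂ, E) ω H]
    [ConnectedSpace H] {G : Subgroup H} (hG : IsRealForm (E := E) G)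
    (hρ : IsHolomorphicRep (E := E) ρ) {W : Submodule ℂ (Fin n → ℂ)}
    (hW : ∀ g ∈ G, ∀ w ∈ W, repCLM ρ g w ∈ W) (h : H) {w : Fin n → ℂ} (hw : w ∈ W) :
    repCLM ρ h w ∈ W := by
  have : IsTopologicalGroup H := topologicalGroup_of_lieGroup 𝓘(ℂ, E) ω
  have : IsManifold 𝓘(ℂ, E) 1 H := IsManifold.of_le (n := ω) le_top
  have hnhds := eventually_repCLM_apply_mem hρ fun Z w hw => hG.repDeriv_apply_mem hρ hW Z hw
  -- Stability under both `h` and `h⁻¹` makes `K` a subgroup. It is a neighbourhood of `1`, hence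
  -- open and closed, hence all of the connected group `H`.
  let K : Subgroup H :=
    { carrier := {h | (∀ w ∈ W, repCLM ρ h w ∈ W) ∧ ∀ w ∈ W, repCLM ρ h⁻¹ w ∈ W}
      one_mem' := by simp [repCLM_one]
      mul_mem' := by
        rintro a b ⟨ha, ha'⟩ ⟨hb, hb'⟩
        refine ⟨fun w hw => ?_, fun w hw => ?_⟩
        · rw [repCLM_mul]
          exact ha _ (hb w hw)
        · rw [mul_inv_rev, repCLM_mul]
          exact hb' _ (ha' w hw)
      inv_mem' := by
        rintro a ⟨ha, ha'⟩
        exact ⟨ha', by rwa [inv_inv]⟩ }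
  have hinv : Filter.Tendsto (fun h : H => h⁻¹) (𝓝 1) (𝓝 1) := by
    simpa using continuous_inv.tendsto (1 : H)
  have hK : (K : Set H) ∈ 𝓝 (1 : H) := hnhds.and (hinv.eventually hnhds)
  have hopen := K.isOpen_of_mem_nhds hK
  have huniv : (K : Set H) = Set.univ :=
    IsClopen.eq_univ ⟨K.isClosed_of_isOpen hopen, hopen⟩ ⟨1, K.one_mem⟩
  have hh : h ∈ (K : Set H) := huniv ▸ Set.mem_univ h
  exact hh.1 w hw

end InvariantSubspaces

/-! ### Antilinear lifts of anti-holomorphic involutions -/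

section AntilinearMaps

variable {n : ℕ}

/-- An anti-holomorphic involution of `ℙ(ℂⁿ)` is induced by an antilinear map. -/
theorem IsAntiholomorphic.exists_antilinear {T : ℙ ℂ (Fin n → ℂ) → ℙ ℂ (Fin n → ℂ)}
    (hT : IsAntiholomorphic T) (hTinv : Function.Involutive T) :
    ∃ τ : (Fin n → ℂ) →ₛₗ[starRingEnd ℂ] (Fin n → ℂ),
      ∀ (v : Fin n → ℂ) (hv : v ≠ 0), ∃ hτ : τ v ≠ 0,
        T (Projectivization.mk ℂ v hv) = Projectivization.mk ℂ (τ v) hτ := by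
  let σ : (Fin n → ℂ) →ₛₗ[starRingEnd ℂ] (Fin n → ℂ) :=
    { toFun := star
      map_add' := star_add
      map_smul' := star_smul }
  have hσ : Function.Injective σ := star_injective
  let C : ℙ ℂ (Fin n → ℂ) → ℙ ℂ (Fin n → ℂ) := Projectivization.map σ hσ
  have hstar : ∀ v : Fin n → ℂ, v ≠ 0 → star v ≠ 0 := fun v hv => star_ne_zero.mpr hv
  have hC : ∀ (v : Fin n → ℂ) (hv : v ≠ 0),
      C (Projectivization.mk ℂ v hv) = Projectivization.mk ℂ (star v) (hstar v hv) :=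
    fun v hv => rfl
  have hCC : ∀ p, C (C p) = p := by
    intro p
    induction p using Projectivization.ind with
    | h v hv => simp only [hC, star_star]
  -- Conjugation `C` turns `T` into a holomorphic map `C ∘ T` with holomorphic inverse `T ∘ C`, to
  -- which `IsHolomorphicMap.exists_linear` applies.
  have hS : IsHolomorphicMap (C ∘ T) := by
    intro v hv
    obtain ⟨U, hU, hvU, F, hF, hFT⟩ := hT v hv
    refine ⟨U ∩ {0}ᶜ, fun x => star (F x), ⟨hvU, hv⟩, hU.inter isOpen_compl_singleton,
      hF.mono Set.inter_subset_left, fun x hx => ?_⟩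
    obtain ⟨hFx, e⟩ := hFT x hx.1 hx.2
    exact ⟨hx.2, hstar _ hFx, by rw [Function.comp_apply, e, hC]⟩
  have hR : IsHolomorphicMap (T ∘ C) := by
    intro v hv
    obtain ⟨U, hU, hvU, F, hF, hFT⟩ := hT (star v) (hstar v hv)
    refine ⟨star ⁻¹' U ∩ {0}ᶜ, fun x => F (star x), ⟨hvU, hv⟩,
      (hU.preimage continuous_star).inter isOpen_compl_singleton, fun x hx => ?_, fun x hx => ?_⟩
    · have h1 := (hF.differentiableAt (hU.mem_nhds hx.1)).star_star
      rw [star_star] at h1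
      refine (h1.congr_of_eventuallyEq ?_).differentiableWithinAt
      exact Filter.Eventually.of_forall fun y => by simp
    · obtain ⟨hFx, e⟩ := hFT (star x) hx.1 (hstar x hx.2)
      exact ⟨hx.2, hFx, (congrArg T (hC x hx.2)).trans e⟩
  obtain ⟨A, hA⟩ := hS.exists_linear hR fun p => by
    simp only [Function.comp_apply, hCC, hTinv p]
  refine ⟨σ.comp A, fun v hv => ?_⟩
  obtain ⟨hAv, e⟩ := hA v hv
  refine ⟨hstar _ hAv, ?_⟩
  rw [← hCC (T _)]
  exact congrArg C e

/-- If `τ` is an antilinear involution and `τ B τ = c B` with `det B = 1`, then `cⁿ = 1`. -/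
theorem pow_eq_one_of_conj_eq_smul {τ : (Fin n → ℂ) →ₛₗ[starRingEnd ℂ] (Fin n → ℂ)}
    (hτ : ∀ v, τ (τ v) = v) {B : Matrix (Fin n) (Fin n) ℂ} (hB : B.det = 1) {c : ℂ}
    (h : ∀ v, τ (B *ᵥ τ v) = c • B *ᵥ v) : c ^ n = 1 := by
  -- With `A` the matrix of `v ↦ star (τ v)`, the hypotheses read `Ā A = 1` and `Ā B̄ A = c B`.
  -- Taking determinants gives `1 = cⁿ`.
  let L : (Fin n → ℂ) →ₗ[ℂ] (Fin n → ℂ) :=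
    { toFun := fun v => star (τ v)
      map_add' := fun v w => by simp
      map_smul' := fun c v => by ext; simp }
  set A := LinearMap.toMatrix' L
  have hA : ∀ v, A *ᵥ v = star (τ v) := fun v => by
    simp only [A, LinearMap.toMatrix'_mulVec]
    rfl
  have hAτ : ∀ v, τ v = A.map star *ᵥ star v := fun v => by
    rw [← star_star (τ v), ← hA, Matrix.star_mulVec, ← Matrix.mulVec_transpose]
    rfl
  have hmap : ∀ M N : Matrix (Fin n) (Fin n) ℂ, (M * N).map star = M.map star * N.map star :=
    fun M N => Matrix.map_mul (f := starRingEnd ℂ)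
  have hstar : ∀ (M : Matrix (Fin n) (Fin n) ℂ) v, star (M *ᵥ v) = M.map star *ᵥ star v :=
    fun M v => by
      rw [Matrix.star_mulVec, ← Matrix.mulVec_transpose]
      rfl
  have hdet : ∀ M : Matrix (Fin n) (Fin n) ℂ, (M.map star).det = star M.det := fun M =>
    ((starRingEnd ℂ).map_det M).symm
  have h1 : A.map star * A = 1 := by
    refine Matrix.toLin'.injective (LinearMap.ext fun v => ?_)
    simp only [Matrix.toLin'_apply, ← Matrix.mulVec_mulVec, hA, Matrix.one_mulVec]
    rw [← hAτ, hτ]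
  have h2 : A.map star * B.map star * A = c • B := by
    refine Matrix.toLin'.injective (LinearMap.ext fun v => ?_)
    simp only [Matrix.toLin'_apply, ← Matrix.mulVec_mulVec, hA, Matrix.smul_mulVec]
    rw [← hstar, ← hAτ, h]
  have h3 := congrArg Matrix.det h1
  have h4 := congrArg Matrix.det h2
  rw [Matrix.det_mul, Matrix.det_one] at h3
  rw [Matrix.det_mul, Matrix.det_mul, hdet B, hB, star_one, mul_one, h3, Matrix.det_smul, hB,
    mul_one, Fintype.card_fin] at h4
  exact h4.symm

end AntilinearMaps

/-! ### Schur-type arguments along an orbit of the real form -/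

section Orbits

variable {E : Type*} [NormedAddCommGroup E] [NormedSpace ℂ E] [FiniteDimensional ℂ E]
  {H : Type*} [TopologicalSpace H] [ChartedSpace E H] [Group H]
  [LieGroup 𝓘(ℂ, E) ω H] [ConnectedSpace H] {n : ℕ}
  {ρ : H →* Matrix.SpecialLinearGroup (Fin n) ℂ} {G : Subgroup H}

/-- Irreducibility under `H` descends to `G`, because `G`-stable complex subspaces are `H`-stable.
-/
theorem IsRealForm.eq_bot_or_eq_top (hG : IsRealForm (E := E) G)
    (hρ : IsHolomorphicRep (E := E) ρ) (hirr : (complexRep ρ).IsIrreducible)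
    {W : Submodule ℂ (Fin n → ℂ)} (hW : ∀ g ∈ G, ∀ w ∈ W, repCLM ρ g w ∈ W) :
    W = ⊥ ∨ W = ⊤ := by
  let W' : Subrepresentation (complexRep ρ) :=
    ⟨W, fun h w hw => by
      rw [complexRep_apply, ← repCLM_apply]
      exact hG.repCLM_apply_mem hρ hW h hw⟩
  rcases hirr.eq_bot_or_eq_top W' with h | h
  · exact Or.inl (congrArg Subrepresentation.toSubmodule h)
  · exact Or.inr (congrArg Subrepresentation.toSubmodule h)

theorem IsRealForm.span_orbit_eq_top (hG : IsRealForm (E := E) G)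
    (hρ : IsHolomorphicRep (E := E) ρ) (hirr : (complexRep ρ).IsIrreducible)
    {v : Fin n → ℂ} (hv : v ≠ 0) :
    Submodule.span ℂ ((fun g => repCLM ρ g v) '' (G : Set H)) = ⊤ := by
  refine (hG.eq_bot_or_eq_top hρ hirr ?_).resolve_left fun h => hv ?_
  · intro g hg w hw
    induction hw using Submodule.span_induction with
    | mem x hx =>
      obtain ⟨g', hg', rfl⟩ := hx
      refine Submodule.subset_span ⟨g * g', G.mul_mem hg hg', ?_⟩
      simp only [repCLM_mul, ContinuousLinearMap.comp_apply]
    | zero => simp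
    | add x y _ _ hx hy => rw [map_add]; exact Submodule.add_mem _ hx hy
    | smul a x _ hx => rw [map_smul]; exact Submodule.smul_mem _ _ hx
  · rw [Submodule.span_eq_bot] at h
    exact h v ⟨1, G.one_mem, by simp [repCLM_one]⟩

open scoped ComplexOrder in
/-- A linear map having all the vectors of a `G`-orbit as eigenvectors is a scalar. -/
theorem IsRealForm.eq_smul_of_forall_orbit (hG : IsRealForm (E := E) G)
    (hρ : IsHolomorphicRep (E := E) ρ) (hirr : (complexRep ρ).IsIrreducible)
    {v : Fin n → ℂ} (hv : v ≠ 0) (M : (Fin n → ℂ) →ₗ[ℂ] (Fin n → ℂ))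
    (hM : ∀ g ∈ G, ∃ c : ℂ, M (repCLM ρ g v) = c • repCLM ρ g v) {c : ℂ} (hc : M v = c • v)
    (w : Fin n → ℂ) : M w = c • w := by
  set x : H → (Fin n → ℂ) := fun g => repCLM ρ g v
  have hx0 : ∀ g, x g ≠ 0 := fun g => repCLM_apply_ne_zero g hv
  have hdot : ∀ g, star (x g) ⬝ᵥ x g ≠ 0 := fun g h => hx0 g (dotProduct_star_self_eq_zero.mp h)
  have hxc : Continuous x := hρ.continuous.clm_apply continuous_const
  have hMc : Continuous M := M.continuous_of_finiteDimensional
  -- The Rayleigh quotient is continuous on all of `H` and equals the eigenvalue of `M` at `x g`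
  -- when `g ∈ G`. On the connected set `G` it takes values in the finite spectrum of `M`, so it is
  -- constant there.
  set f : H → ℂ := fun g => (star (x g) ⬝ᵥ M (x g)) / (star (x g) ⬝ᵥ x g)
  have hfc : Continuous f := by
    refine Continuous.div ?_ ?_ hdot
    · exact hxc.star.dotProduct (hMc.comp hxc)
    · exact hxc.star.dotProduct hxc
  have hfM : ∀ g ∈ G, M (x g) = f g • x g := by
    intro g hg
    obtain ⟨a, ha⟩ := hM g hg
    have h1 : f g = a := by
      simp only [f, x]
      rw [ha, dotProduct_smul, smul_eq_mul, mul_div_assoc, div_self (hdot g), mul_one]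
    rw [h1]
    exact ha
  have hconst : ∀ g ∈ G, f g = f 1 := fun g hg =>
    hG.isConnected.isPreconnected.constant_of_mapsTo
      (Module.End.finite_hasEigenvalue M).isDiscrete hfc.continuousOn
      (fun g hg => Module.End.hasEigenvalue_of_hasEigenvector
        (Module.End.hasEigenvector_iff.mpr ⟨Module.End.mem_eigenspace_iff.mpr (hfM g hg), hx0 g⟩))
      hg G.one_mem
  have hf1 : f 1 = c := by
    have h1 := hfM 1 G.one_mem
    have h2 : x 1 = v := by simp [x, repCLM_one]
    rw [h2, hc] at h1
    exact (smul_left_injective ℂ hv h1).symm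
  have hw : w ∈ Submodule.span ℂ (x '' (G : Set H)) := by
    rw [hG.span_orbit_eq_top hρ hirr hv]
    trivial
  induction hw using Submodule.span_induction with
  | mem y hy =>
    obtain ⟨g, hg, rfl⟩ := hy
    rw [hfM g hg, hconst g hg, hf1]
  | zero => simp
  | add y z _ _ hy hz => rw [map_add, hy, hz, smul_add]
  | smul a y _ hy => rw [map_smul, hy, smul_comm]

/-- An antilinear map preserving every line of a `G`-orbit and fixing a point of this orbit is an
involution. -/
theorem IsRealForm.antilinear_involutive (hG : IsRealForm (E := E) G)
    (hρ : IsHolomorphicRep (E := E) ρ) (hirr : (complexRep ρ).IsIrreducible)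
    {v : Fin n → ℂ} (hv : v ≠ 0) {τ : (Fin n → ℂ) →ₛₗ[starRingEnd ℂ] (Fin n → ℂ)}
    (hτ : ∀ g ∈ G, ∃ c : ℂ, τ (repCLM ρ g v) = c • repCLM ρ g v) (hτv : τ v = v)
    (w : Fin n → ℂ) : τ (τ w) = w := by
  -- `τ²` is complex linear, with eigenvalue `c̄ c` at an orbit vector where `τ` multiplies by `c`,
  -- and eigenvalue `1` at `v`.
  have h := hG.eq_smul_of_forall_orbit hρ hirr hv (τ.comp τ) (c := 1) (fun g hg => by
    obtain ⟨c, hc⟩ := hτ g hg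
    refine ⟨starRingEnd ℂ c * c, ?_⟩
    rw [LinearMap.comp_apply, hc, map_smulₛₗ, hc, smul_smul]) (by simp [hτv]) w
  simpa using h

/-- An antilinear map preserving every line of a `G`-orbit and fixing a point of this orbit
commutes with `G`. -/
theorem IsRealForm.antilinear_commutes (hG : IsRealForm (E := E) G)
    (hρ : IsHolomorphicRep (E := E) ρ) (hirr : (complexRep ρ).IsIrreducible)
    {v : Fin n → ℂ} (hv : v ≠ 0) {τ : (Fin n → ℂ) →ₛₗ[starRingEnd ℂ] (Fin n → ℂ)}
    (hτ : ∀ g ∈ G, ∃ c : ℂ, τ (repCLM ρ g v) = c • repCLM ρ g v) (hτv : τ v = v)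
    {g : H} (hg : g ∈ G) (w : Fin n → ℂ) : τ (repCLM ρ g w) = repCLM ρ g (τ w) := by
  have hττ := hG.antilinear_involutive hρ hirr hv hτ hτv
  have : IsTopologicalGroup H := topologicalGroup_of_lieGroup 𝓘(ℂ, E) ω
  have hmul : ∀ (a b : H) (w : Fin n → ℂ), repCLM ρ a (repCLM ρ b w) = repCLM ρ (a * b) w :=
    fun a b w => by rw [repCLM_mul]; rfl
  -- The commutator `τ ρ(g) τ⁻¹ ρ(g)⁻¹`, as `τ² = 1`. It is complex linear and preserves each orbit
  -- line, so it is a scalar for `g ∈ G`.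
  let M : H → ((Fin n → ℂ) →ₗ[ℂ] (Fin n → ℂ)) := fun g =>
    (τ.comp (repCLM ρ g : (Fin n → ℂ) →ₗ[ℂ] (Fin n → ℂ))).comp
      (τ.comp (repCLM ρ g⁻¹ : (Fin n → ℂ) →ₗ[ℂ] (Fin n → ℂ)))
  have hMa : ∀ g w, M g w = τ (repCLM ρ g (τ (repCLM ρ g⁻¹ w))) := fun g w => rfl
  have hMe : ∀ g ∈ G, ∀ g' ∈ G, ∃ c : ℂ, M g (repCLM ρ g' v) = c • repCLM ρ g' v := by
    intro g hg g' hg'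
    obtain ⟨a, ha⟩ := hτ _ (G.mul_mem (G.inv_mem hg) hg')
    obtain ⟨b, hb⟩ := hτ _ hg'
    refine ⟨starRingEnd ℂ a * b, ?_⟩
    rw [hMa, hmul, ha, map_smul, hmul, mul_inv_cancel_left, map_smulₛₗ, hb, smul_smul]
  have hMc : ∀ g ∈ G, ∃ c : ℂ, ∀ w, M g w = c • w := by
    intro g hg
    obtain ⟨c, hc⟩ := hMe g hg 1 G.one_mem
    simp only [repCLM_one, ContinuousLinearMap.id_apply] at hc
    exact ⟨c, hG.eq_smul_of_forall_orbit hρ hirr hv (M g) (hMe g hg) hc⟩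
  obtain ⟨i, hi⟩ := Function.ne_iff.mp hv
  have hi' : v i ≠ 0 := hi
  have hn : n ≠ 0 := by
    rintro rfl
    exact i.elim0
  -- Reading the scalar off a nonzero coordinate of `v` makes its continuity in `g` visible.
  set f : H → ℂ := fun g => M g v i / v i
  have hfM : ∀ g ∈ G, ∀ w, M g w = f g • w := by
    intro g hg
    obtain ⟨c, hc⟩ := hMc g hg
    have h1 : f g = c := by simp [f, hc, hi']
    rw [h1]
    exact hc
  have hτc : Continuous τ := by
    let τr : (Fin n → ℂ) →ₗ[ℝ] (Fin n → ℂ) :=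
      { toFun := τ
        map_add' := map_add τ
        map_smul' := fun r w => by
          have := map_smulₛₗ τ (r : ℂ) w
          simpa using this }
    exact τr.continuous_of_finiteDimensional
  have hfc : Continuous f := by
    have h1 : Continuous fun g : H => τ (repCLM ρ g (τ (repCLM ρ g⁻¹ v))) :=
      hτc.comp (hρ.continuous.clm_apply (hτc.comp
        ((hρ.continuous.comp continuous_inv).clm_apply continuous_const)))
    exact ((continuous_apply i).comp h1).div_const _
  have hpow : ∀ g ∈ G, f g ^ n = 1 := by
    intro g hg
    refine pow_eq_one_of_conj_eq_smul hττ (ρ g).2 fun w => ?_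
    have h1 := hfM g hg (repCLM ρ g w)
    rw [hMa, hmul, inv_mul_cancel, repCLM_one, ContinuousLinearMap.id_apply] at h1
    rw [← repCLM_apply, h1, repCLM_apply]
  have hf1 : f 1 = 1 := by
    simp only [f, hMa, inv_one, repCLM_one, ContinuousLinearMap.id_apply, hττ]
    exact div_self hi'
  have hf : f g = 1 := by
    rw [← hf1]
    exact hG.isConnected.isPreconnected.constant_of_mapsTo
      (finite_setOf_pow_eq hn 1).isDiscrete hfc.continuousOn hpow hg G.one_mem
  have h1 := hfM g hg (repCLM ρ g (τ w))
  rw [hMa, hmul, inv_mul_cancel, repCLM_one, ContinuousLinearMap.id_apply, hττ, hf, one_smul] at h1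
  exact h1

/-- An antilinear involution commuting with a real form defines a real representation. -/
theorem IsRealForm.exists_real_subrepresentation (hG : IsRealForm (E := E) G)
    (hρ : IsHolomorphicRep (E := E) ρ) (hirr : (complexRep ρ).IsIrreducible)
    {τ : (Fin n → ℂ) →ₛₗ[starRingEnd ℂ] (Fin n → ℂ)} (hττ : ∀ w, τ (τ w) = w)
    (hτG : ∀ g ∈ G, ∀ w, τ (repCLM ρ g w) = repCLM ρ g (τ w))
    {v : Fin n → ℂ} (hv : v ≠ 0) (hτv : τ v = v) :
    ∃ V : Subrepresentation (realRep ρ G),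
      V.toRepresentation.IsIrreducible ∧ ComplexificationEqTop V.toSubmodule := by
  have hreal : ∀ (r : ℝ) (w : Fin n → ℂ), τ (r • w) = r • τ w := fun r w => by
    have := map_smulₛₗ τ (r : ℂ) w
    simpa using this
  have hrep : ∀ (g : G) (w : Fin n → ℂ), realRep ρ G g w = repCLM ρ (g : H) w := fun g w => by
    rw [repCLM_apply]
    rfl
  have hmulI : ∀ w : Fin n → ℂ, mulI n w = Complex.I • w := fun w => rfl
  have hτI : ∀ w : Fin n → ℂ, τ (Complex.I • w) = -(Complex.I • τ w) := fun w => by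
    rw [map_smulₛₗ, Complex.conj_I, neg_smul]
  let V : Subrepresentation (realRep ρ G) :=
    { toSubmodule :=
        { carrier := {w | τ w = w}
          add_mem' := fun {a b} ha hb => by
            change τ (a + b) = a + b
            rw [map_add, ha, hb]
          zero_mem' := map_zero τ
          smul_mem' := fun r w hw => by
            change τ (r • w) = r • w
            rw [hreal, hw] }
      apply_mem_toSubmodule := fun g w hw => by
        change τ (realRep ρ G g w) = realRep ρ G g w
        rw [hrep, hτG g g.2]
        exact congrArg _ hw }
  have hVmem : ∀ w, w ∈ V.toSubmodule ↔ τ w = w := fun w => Iff.rfl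
  refine ⟨V, ?_, ?_⟩
  · have hnontriv : Nontrivial (Subrepresentation V.toRepresentation) := by
      refine ⟨⟨⊥, ⊤, fun h => hv ?_⟩⟩
      have h1 : (⟨v, hτv⟩ : V.toSubmodule) ∈
          (⊥ : Subrepresentation V.toRepresentation).toSubmodule := by
        rw [h]
        trivial
      exact congrArg Subtype.val ((Submodule.mem_bot ℝ).mp h1)
    refine { toNontrivial := hnontriv, eq_bot_or_eq_top := fun K => ?_ }
    set K' : Submodule ℝ (Fin n → ℂ) := K.toSubmodule.map V.toSubmodule.subtype
    have hK'V : ∀ w ∈ K', τ w = w := by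
      rintro _ ⟨w, -, rfl⟩
      exact w.2
    have hK'G : ∀ g ∈ G, ∀ w ∈ K', repCLM ρ g w ∈ K' := by
      rintro g hg _ ⟨w, hw, rfl⟩
      exact ⟨_, K.apply_mem_toSubmodule ⟨g, hg⟩ hw, hrep ⟨g, hg⟩ w⟩
    have hKK' : ∀ w : V.toSubmodule, (w : Fin n → ℂ) ∈ K' → w ∈ K.toSubmodule := by
      rintro w ⟨w', hw', e⟩
      rwa [← Subtype.ext (show (w' : Fin n → ℂ) = w from e)]
    -- The complex span of the real subspace `K'` is `G`-stable, so it is `0` or `ℂⁿ`. In the second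
    -- case `K'` is recovered as the real part of its span with respect to `τ`.
    set W : Submodule ℂ (Fin n → ℂ) := Submodule.span ℂ (K' : Set (Fin n → ℂ))
    have hWG : ∀ g ∈ G, ∀ w ∈ W, repCLM ρ g w ∈ W := by
      intro g hg w hw
      induction hw using Submodule.span_induction with
      | mem x hx => exact Submodule.subset_span (hK'G g hg x hx)
      | zero => simp
      | add x y _ _ hx hy => rw [map_add]; exact Submodule.add_mem _ hx hy
      | smul a x _ hx => rw [map_smul]; exact Submodule.smul_mem _ _ hx
    rcases hG.eq_bot_or_eq_top hρ hirr hWG with hW | hW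
    · refine Or.inl (Subrepresentation.toSubmodule_injective ?_)
      refine (Submodule.eq_bot_iff _).mpr fun w hw => Subtype.ext ?_
      exact (Submodule.span_eq_bot.mp hW) _ ⟨w, hw, rfl⟩
    · refine Or.inr (Subrepresentation.toSubmodule_injective ?_)
      refine Submodule.eq_top_iff'.mpr fun w => hKK' w ?_
      -- For `x ∈ K'` the sum is `2 Re(c) x`. The free scalar `c` lets the induction absorb complex
      -- multiples.
      have hsum : ∀ x ∈ W, ∀ c : ℂ, c • x + τ (c • x) ∈ K' := by
        intro x hx
        induction hx using Submodule.span_induction with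
        | mem x hx =>
          intro c
          have h1 : c • x + τ (c • x) = (2 * c.re) • x := by
            rw [map_smulₛₗ, hK'V x hx, ← add_smul, Complex.add_conj]
            exact (Complex.coe_smul _ _)
          rw [h1]
          exact K'.smul_mem _ hx
        | zero => simp
        | add x y _ _ hx hy =>
          intro c
          have h1 : c • (x + y) + τ (c • (x + y))
              = (c • x + τ (c • x)) + (c • y + τ (c • y)) := by
            rw [smul_add, map_add]; abel
          rw [h1]
          exact K'.add_mem (hx c) (hy c)
        | smul a x _ hx =>
          intro c
          rw [smul_smul]
          exact hx _
      have h2 := hsum w (hW ▸ Submodule.mem_top) 1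
      rw [one_smul, (hVmem w).mp w.2, ← two_smul ℝ] at h2
      have h3 := K'.smul_mem (2⁻¹ : ℝ) h2
      rwa [smul_smul, inv_mul_cancel₀ two_ne_zero, one_smul] at h3
  · refine ⟨?_, ?_⟩
    · rw [Submodule.disjoint_def]
      rintro _ hw ⟨x, hx, rfl⟩
      rw [hVmem, hmulI, hτI, (hVmem x).mp hx] at hw
      rw [hmulI]
      have h1 : (2 : ℝ) • (Complex.I • x) = 0 := by
        rw [two_smul]
        nth_rewrite 1 [← hw]
        exact neg_add_cancel _
      exact (smul_eq_zero.mp h1).resolve_left two_ne_zero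
    · rw [codisjoint_iff, Submodule.eq_top_iff']
      intro x
      rw [Submodule.mem_sup]
      -- The splitting `x = (x + τ x)/2 + i · (-i (x - τ x)/2)`, in which both halves are fixed by
      -- `τ`.
      refine ⟨(2⁻¹ : ℝ) • (x + τ x), ?_, mulI n ((2⁻¹ : ℝ) • -(Complex.I • (x - τ x))),
        ⟨_, ?_, rfl⟩, ?_⟩
      · rw [hVmem, hreal, map_add, hττ, add_comm]
      · change τ _ = _
        rw [hreal, map_neg, hτI, map_sub, hττ, neg_neg, ← smul_neg, neg_sub]
      · rw [hmulI, smul_comm, smul_neg, smul_smul, Complex.I_mul_I, neg_one_smul, neg_neg,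
          ← smul_add, add_add_sub_cancel, ← two_smul ℝ x, smul_smul,
          inv_mul_cancel₀ two_ne_zero, one_smul]

end Orbits
end RealForm

end

theorem mainTheorem7
    {E : Type*} [NormedAddCommGroup E] [NormedSpace ℂ E] [FiniteDimensional ℂ E]
    [CompleteSpace E]
    {H : Type*} [TopologicalSpace H] [ChartedSpace E H] [Group H]
    [LieGroup 𝓘(ℂ, E) ω H] [ConnectedSpace H]
    [LieAlgebra.IsSemisimple ℂ (GroupLieAlgebra 𝓘(ℂ, E) H)]
    (n : ℕ) (ρ : H →* Matrix.SpecialLinearGroup (Fin n) ℂ)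
    (hρ : RealForm.IsHolomorphicRep (E := E) ρ)
    (hirr : (RealForm.complexRep ρ).IsIrreducible)
    (G : Subgroup H) (hG : RealForm.IsRealForm (E := E) G)
    (hnc : ¬ IsCompact (G : Set H))
    (O' O : Set (ℙ ℂ (Fin n → ℂ)))
    (hO' : RealForm.IsCompactOrbit ρ ⊤ O')
    (hO : RealForm.IsCompactOrbit ρ G O) (hOO' : O ⊆ O')
    (T : ℙ ℂ (Fin n → ℂ) → ℙ ℂ (Fin n → ℂ))
    (hT : RealForm.IsAntiholomorphic T) (hTinv : Function.Involutive T)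
    (hTO' : Set.MapsTo T O' O') (hTO : ∀ p ∈ O, T p = p) :
    ∃ V : Subrepresentation (RealForm.realRep ρ G),
      V.toRepresentation.IsIrreducible ∧
        RealForm.ComplexificationEqTop V.toSubmodule := by
  obtain ⟨τ, hτ⟩ := hT.exists_antilinear hTinv
  obtain ⟨-, p, rfl⟩ := hO
  induction p using Projectivization.ind with
  | h v hv =>
  have hfix : ∀ g ∈ G, ∃ c : ℂ, τ (RealForm.repCLM ρ g v) = c • RealForm.repCLM ρ g v := by
    intro g hg
    have hgv := RealForm.repCLM_apply_ne_zero (ρ := ρ) g hv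
    have hmem : Projectivization.mk ℂ (RealForm.repCLM ρ g v) hgv ∈
        MulAction.orbit (G.map ρ) (Projectivization.mk ℂ v hv) := by
      refine ⟨⟨ρ g, Subgroup.mem_map_of_mem ρ hg⟩, ?_⟩
      change ρ g • Projectivization.mk ℂ v hv = _
      rw [Projectivization.smul_mk]
      congr 1
    obtain ⟨h0, e⟩ := hτ _ hgv
    rw [hTO _ hmem] at e
    obtain ⟨c, hc⟩ := (Projectivization.mk_eq_mk_iff' ℂ _ _ _ _).mp e.symm
    exact ⟨c, hc.symm⟩
  obtain ⟨c, hc⟩ := hfix 1 G.one_mem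
  simp only [RealForm.repCLM_one, ContinuousLinearMap.id_apply] at hc
  have hc0 : c ≠ 0 := by
    rintro rfl
    obtain ⟨h0, -⟩ := hτ v hv
    exact h0 (by rw [hc, zero_smul])
  -- Dividing `τ` by its factor `c` at `v` makes `v` itself fixed and still preserves every orbit
  -- line.
  have hfix' : ∀ g ∈ G, ∃ a : ℂ,
      (c⁻¹ • τ) (RealForm.repCLM ρ g v) = a • RealForm.repCLM ρ g v := by
    intro g hg
    obtain ⟨a, ha⟩ := hfix g hg
    exact ⟨c⁻¹ * a, by rw [LinearMap.smul_apply, ha, smul_smul]⟩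
  have hv' : (c⁻¹ • τ) v = v := by
    rw [LinearMap.smul_apply, hc, smul_smul, inv_mul_cancel₀ hc0, one_smul]
  exact hG.exists_real_subrepresentation hρ hirr
    (hG.antilinear_involutive hρ hirr hv hfix' hv')
    (fun g hg w => hG.antilinear_commutes hρ hirr hv hfix' hv' hg w) hv hv'
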